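/- Let $H$ be a Hopf algebra over a field $k$ with comultiplication $\Delta(h)=h^1\otimes h^2$ and invertible antipode $S$, and let $\mathcal{M}^H$ be the monoidal category of right $H$-comodules, with coactions $\rho(v)=v_0\otimes v_1$ and $\rho(v\otimes w)=v_0\otimes w_0\otimes v_1w_1$. For $W,V\in\mathcal{M}^H$ and $f\in\mathrm{Hom}_k(W,V)$ put $$\rho^l f(w)=f(w_0)_0\otimes f(w_0)_1S(w_1),\qquad \rho^r f(w)=f(w_0)_0\otimes S^{-1}(w_1)f(w_0)_1 ,$$ and let $\mathrm{Hom}^l(W,V)$ (resp. $\mathrm{Hom}^r(W,V)$) be the subspace of those $f$ with $\rho^l f$ (resp. $\rho^r f$) in $\mathrm{Hom}_k(W,V)\otimes H\subset \mathrm{Hom}_k(W,V\otimes H)$; it is a right $H$-comodule with coaction $\rho^l$ (resp. $\rho^r$). Let $\mathcal{M}^{H\,op}$ be the opposite category of $\mathcal{M}^H$, regarded as a bimodule category over $\mathcal{M}^H$ by $$W\triangleright V=\mathrm{Hom}^l(W,V),\qquad V\triangleleft W=\mathrm{Hom}^r(W,V),$$ with the associativity, unit and middle constraints given by currying, evaluation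 at $1\in k$ and exchange of arguments. An object of its center $\mathcal{Z}_{\mathcal{M}^H}(\mathcal{M}^{H\,op})$ is a comodule $M$ with isomorphisms of comodules $\tau_W:\mathrm{Hom}^l(W,M)\to\mathrm{Hom}^r(W,M)$, natural in $W\in\mathcal{M}^H$, such that $\tau_k$ is the identity of $M$ under $k\triangleright M\cong M\cong M\triangleleft k$ and such that, for all $W,V$, $\tau_{W\otimes V}$ agrees with the composite $$(W\otimes V)\triangleright M\cong W\triangleright(V\triangleright M)\to W\triangleright(M\triangleleft V)\cong(W\triangleright M)\triangleleft V\to(M\triangleleft W)\triangleleft V\cong M\triangleleft(W\otimes V)$$ of $\mathrm{Id}\triangleright\tau_V$ and $\tau_W\triangleleft\mathrm{Id}$ with the constraints. A morphism $(M,\tau)\to(M',\tau')$ is written here as a morphism $\theta:M\to M'$ of $\mathcal{M}^H$ (that is, a morphism from $M'$ to $M$ in $\mathcal{M}^{H\,op}$) with $\theta\circ\tau_W(f)=\tau'_W(\theta\circ f)$ for all $W$ and $f$. A left-right anti-Yetter–Drinfeld module is a left $H$-module and right $H$-comodule $M$ with $$(hm)_0\otimes(hm)_1=h^2m_0\otimes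 h^3m_1S(h^1)\qquad (h\in H,\ m\in M);$$ morphisms are the $H$-linear morphisms of comodules. Then the category of left-right anti-Yetter–Drinfeld modules over $H$ is equivalent to $\mathcal{Z}_{\mathcal{M}^H}(\mathcal{M}^{H\,op})$. More precisely, there is an equivalence that is the identity on underlying comodules and on underlying morphisms and sends $M$ to $(M,\tau)$ with $\tau_Wf(w)=w_1f(w_0)$. -/

import Mathlib

universe u v₁ v₂ u₁ u₂

open scoped TensorProduct
open CategoryTheory Opposite

noncomputable section

/-! ## Right comodules over a coalgebra -/

/-- A right comodule `V` over a `k`-coalgebra `H`, with coaction `ρ(v) = v₀ ⊗ v₁`. -/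
class RightComodule (k H V : Type*) [Field k] [AddCommGroup H] [Module k H] [Coalgebra k H]
    [AddCommGroup V] [Module k V] where
  /-- The coaction `V → V ⊗ H`. -/
  coact : V →ₗ[k] V ⊗[k] H
  coassoc : (TensorProduct.assoc k V H H).toLinearMap ∘ₗ coact.rTensor H ∘ₗ coact =
    (Coalgebra.comul (R := k) (A := H)).lTensor V ∘ₗ coact
  lTensor_counit_comp_coact :
    (Coalgebra.counit (R := k) (A := H)).lTensor V ∘ₗ coact = (TensorProduct.mk k V k).flip 1

namespace RightComodule

variable {k H V : Type*} [Field k] [AddCommGroup H] [Module k H] [Coalgebra k H]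
    [AddCommGroup V] [Module k V] [RightComodule k H V]

theorem coassoc_apply (v : V) :
    (TensorProduct.assoc k V H H) ((coact (k := k) (H := H)).rTensor H (coact v)) =
      (Coalgebra.comul (R := k) (A := H)).lTensor V (coact v) :=
  LinearMap.congr_fun coassoc v

theorem coassoc_apply' (v : V) :
    (coact (k := k) (H := H)).rTensor H (coact v) = (TensorProduct.assoc k V H H).symm
      ((Coalgebra.comul (R := k) (A := H)).lTensor V (coact v)) := by
  rw [← coassoc_apply, LinearEquiv.symm_apply_apply]

theorem counit_apply (v : V) :
    (Coalgebra.counit (R := k) (A := H)).lTensor V (coact v) = v ⊗ₜ[k] (1 : k) :=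
  LinearMap.congr_fun lTensor_counit_comp_coact v

end RightComodule

open RightComodule

section Bialgebra

variable {k H : Type*} [Field k] [Ring H] [Bialgebra k H]

/-- The trivial comodule `k`, with coaction `a ↦ a ⊗ 1`. -/
instance RightComodule.unit : RightComodule k H k where
  coact := (TensorProduct.mk k k H).flip 1
  coassoc := by ext; simp [Algebra.TensorProduct.one_def]
  lTensor_counit_comp_coact := by ext; simp

theorem coact_unit (c : k) : (coact c : k ⊗[k] H) = c ⊗ₜ 1 := rfl

variable {V W : Type*} [AddCommGroup V] [Module k V] [RightComodule k H V]
  [AddCommGroup W] [Module k W] [RightComodule k H W]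

variable (k H V W) in
/-- The coaction `v ⊗ w ↦ (v₀ ⊗ w₀) ⊗ v₁ w₁` on a tensor product. -/
def tensorCoact : V ⊗[k] W →ₗ[k] (V ⊗[k] W) ⊗[k] H :=
  (LinearMap.mul' k H).lTensor (V ⊗[k] W) ∘ₗ
    (TensorProduct.tensorTensorTensorComm k V H W H).toLinearMap ∘ₗ
    TensorProduct.map (coact (k := k) (H := H)) (coact (k := k) (H := H))

theorem tensorCoact_tmul (v : V) (w : W) : tensorCoact k H V W (v ⊗ₜ w) =
    TensorProduct.map₂ (TensorProduct.mk k V W) (LinearMap.mul k H) (coact v) (coact w) := by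
  simp only [tensorCoact, LinearMap.comp_apply, TensorProduct.map_tmul]
  generalize (coact v : V ⊗[k] H) = x
  generalize (coact w : W ⊗[k] H) = y
  induction x with
  | zero => simp
  | add x x' hx hx' => simp only [TensorProduct.add_tmul, map_add, hx, hx', LinearMap.add_apply]
  | tmul a b =>
    induction y with
    | zero => simp
    | add x x' hx hx' => simp only [TensorProduct.tmul_add, map_add, hx, hx']
    | tmul c d => simp

instance RightComodule.tensor : RightComodule k H (V ⊗[k] W) where
  coact := tensorCoact k H V W
  coassoc := by
    ext v w
    simp only [TensorProduct.AlgebraTensorModule.curry_apply, LinearMap.restrictScalars_self,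
      TensorProduct.curry_apply, LinearMap.comp_apply, LinearEquiv.coe_coe]
    rw [tensorCoact_tmul]
    have key : ∀ (x : V ⊗[k] H) (y : W ⊗[k] H),
        TensorProduct.assoc k (V ⊗[k] W) H H ((tensorCoact k H V W).rTensor H
          (TensorProduct.map₂ (TensorProduct.mk k V W) (LinearMap.mul k H) x y)) =
        TensorProduct.map₂ (TensorProduct.mk k V W)
          (TensorProduct.map₂ (LinearMap.mul k H) (LinearMap.mul k H))
          (TensorProduct.assoc k V H H ((coact (k := k) (H := H)).rTensor H x))
          (TensorProduct.assoc k W H H ((coact (k := k) (H := H)).rTensor H y)) := by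
      intro x y
      induction x with
      | zero => simp
      | add x x' hx hx' => simp only [map_add, hx, hx', LinearMap.add_apply]
      | tmul a b =>
        induction y with
        | zero => simp
        | add x x' hx hx' => simp only [map_add, hx, hx']
        | tmul c d =>
          simp only [TensorProduct.map₂_apply_tmul, TensorProduct.map_tmul,
            LinearMap.rTensor_tmul, TensorProduct.mk_apply, tensorCoact_tmul]
          generalize (coact a : V ⊗[k] H) = x
          generalize (coact c : W ⊗[k] H) = y
          induction x with
          | zero => simp
          | add x x' hx hx' =>
            simp only [TensorProduct.add_tmul, map_add, hx, hx', LinearMap.add_apply]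
          | tmul a b =>
            induction y with
            | zero => simp
            | add x x' hx hx' => simp only [TensorProduct.add_tmul, map_add, hx, hx']
            | tmul c d => simp
    rw [key, coassoc_apply, coassoc_apply]
    generalize (coact v : V ⊗[k] H) = x
    generalize (coact w : W ⊗[k] H) = y
    induction x with
    | zero => simp
    | add x x' hx hx' => simp only [map_add, hx, hx', LinearMap.add_apply]
    | tmul a b =>
      induction y with
      | zero => simp
      | add x x' hx hx' => simp only [map_add, hx, hx']
      | tmul c d =>
        simp only [TensorProduct.map₂_apply_tmul, TensorProduct.map_tmul,
          LinearMap.lTensor_tmul, LinearMap.mul_apply',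
          TensorProduct.mk_apply, Bialgebra.comul_mul]
        congr 1
        generalize (Coalgebra.comul (R := k) b : H ⊗[k] H) = x
        generalize (Coalgebra.comul (R := k) d : H ⊗[k] H) = y
        induction x with
        | zero => simp
        | add x x' hx hx' => simp only [add_mul, map_add, hx, hx', LinearMap.add_apply]
        | tmul a b =>
          induction y with
          | zero => simp
          | add x x' hx hx' => simp only [mul_add, map_add, hx, hx']
          | tmul c d => simp
  lTensor_counit_comp_coact := by
    ext v w
    simp only [TensorProduct.AlgebraTensorModule.curry_apply, LinearMap.restrictScalars_self,
      TensorProduct.curry_apply, LinearMap.comp_apply, LinearMap.flip_apply,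
      TensorProduct.mk_apply]
    rw [tensorCoact_tmul]
    have key : ∀ (x : V ⊗[k] H) (y : W ⊗[k] H),
        (Coalgebra.counit (R := k) (A := H)).lTensor (V ⊗[k] W)
          (TensorProduct.map₂ (TensorProduct.mk k V W) (LinearMap.mul k H) x y) =
        TensorProduct.map₂ (TensorProduct.mk k V W) (LinearMap.mul k k)
          ((Coalgebra.counit (R := k) (A := H)).lTensor V x)
          ((Coalgebra.counit (R := k) (A := H)).lTensor W y) := by
      intro x y
      induction x with
      | zero => simp
      | add x x' hx hx' => simp only [map_add, hx, hx', LinearMap.add_apply]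
      | tmul a b =>
        induction y with
        | zero => simp
        | add x x' hx hx' => simp only [map_add, hx, hx']
        | tmul c d => simp
    rw [key, counit_apply, counit_apply]
    simp

theorem coact_tmul (v : V) (w : W) : (coact (v ⊗ₜ w) : (V ⊗[k] W) ⊗[k] H) =
    TensorProduct.map₂ (TensorProduct.mk k V W) (LinearMap.mul k H) (coact v) (coact w) :=
  tensorCoact_tmul v w

end Bialgebra

/-! ## Twisted coactions on spaces of linear maps -/

/-- The canonical map `Hom(W, V) ⊗ H → Hom(W, V ⊗ H)`. -/
abbrev homTensor (k H W V : Type*) [Field k] [AddCommGroup H] [Module k H] [AddCommGroup V]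
    [Module k V] [AddCommGroup W] [Module k W] :
    (W →ₗ[k] V) ⊗[k] H →ₗ[k] (W →ₗ[k] V ⊗[k] H) :=
  TensorProduct.rTensorHomToHomRTensor (RingHom.id k) W V H

theorem homTensor_injective (k H W V : Type*) [Field k] [AddCommGroup H] [Module k H]
    [AddCommGroup V] [Module k V] [AddCommGroup W] [Module k W] :
    Function.Injective (homTensor k H W V) := by
  classical
  let b := Module.Basis.ofVectorSpace k H
  have key : ∀ (x : (W →ₗ[k] V) ⊗[k] H) (w : W) (i),
      TensorProduct.equivFinsuppOfBasisRight b (homTensor k H W V x w) i =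
      TensorProduct.equivFinsuppOfBasisRight b x i w := by
    intro x w i
    induction x with
    | zero => simp
    | add x y hx hy => simp only [map_add, LinearMap.add_apply, Finsupp.add_apply, hx, hy]
    | tmul f h => simp
  rw [injective_iff_map_eq_zero]
  intro x hx
  apply (TensorProduct.equivFinsuppOfBasisRight b).injective
  ext i w
  rw [← key, hx]
  simp

section Twist

variable {k H : Type*} [Field k] [Ring H] [Bialgebra k H]

variable (k H) in
/-- Two mutually inverse bilinear operations `op`, `inv` on `H`.  The instances used below are
`op a h = a * S h`, `inv a h = a * h` and `op a h = S⁻¹ h * a`, `inv a h = h * a`. -/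
structure CoactionTwist where
  /-- The operation in the coaction `f ↦ (w ↦ f(w₀)₀ ⊗ op (f(w₀)₁) w₁)`. -/
  op : H →ₗ[k] H →ₗ[k] H
  /-- The inverse operation. -/
  inv : H →ₗ[k] H →ₗ[k] H
  inv_op : ∀ a h, TensorProduct.lift (inv ∘ₗ op a) (Coalgebra.comul (R := k) h) =
    Coalgebra.counit (R := k) h • a
  op_inv : ∀ a h, TensorProduct.lift (op ∘ₗ inv a) (Coalgebra.comul (R := k) h) =
    Coalgebra.counit (R := k) h • a
  comul_inv : ∀ a h, Coalgebra.comul (R := k) (inv a h) =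
    TensorProduct.map₂ inv inv (Coalgebra.comul (R := k) a) (Coalgebra.comul (R := k) h)
  counit_inv : ∀ a h, Coalgebra.counit (R := k) (inv a h) =
    Coalgebra.counit (R := k) a * Coalgebra.counit (R := k) h

variable {W V : Type*} [AddCommGroup W] [Module k W] [RightComodule k H W]
  [AddCommGroup V] [Module k V]

/-- For `g(w) = ∑ vᵢ ⊗ hᵢ`, written `g(w) = w⁽¹⁾ ⊗ w⁽²⁾`, this is the map
`w ↦ (w₀)⁽¹⁾ ⊗ β((w₀)⁽²⁾, w₁)`. -/
def twist (β : H →ₗ[k] H →ₗ[k] H) : (W →ₗ[k] V ⊗[k] H) →ₗ[k] (W →ₗ[k] V ⊗[k] H) where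
  toFun g := (TensorProduct.lift β).lTensor V ∘ₗ (TensorProduct.assoc k V H H).toLinearMap ∘ₗ
    g.rTensor H ∘ₗ coact
  map_add' g g' := by ext w; simp [LinearMap.rTensor_add]
  map_smul' c g := by ext w; simp [LinearMap.rTensor_smul]

theorem twist_apply (β : H →ₗ[k] H →ₗ[k] H) (g : W →ₗ[k] V ⊗[k] H) (w : W) :
    twist β g w = (TensorProduct.lift β).lTensor V
      (TensorProduct.assoc k V H H (g.rTensor H (coact w))) := rfl

theorem twist_twist (β γ : H →ₗ[k] H →ₗ[k] H)
    (h : ∀ a h, TensorProduct.lift (γ ∘ₗ β a) (Coalgebra.comul (R := k) h) =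
      Coalgebra.counit (R := k) h • a) (g : W →ₗ[k] V ⊗[k] H) :
    twist γ (twist β g) = g := by
  ext w
  have h1 : ∀ (y : V ⊗[k] H) (u : H), (TensorProduct.lift γ).lTensor V
      (TensorProduct.assoc k V H H (((TensorProduct.lift β).lTensor V ∘ₗ
        (TensorProduct.assoc k V H H).toLinearMap ∘ₗ TensorProduct.mk k (V ⊗[k] H) H y).rTensor H
          (Coalgebra.comul (R := k) u))) = Coalgebra.counit (R := k) u • y := by
    intro y u
    induction y with
    | zero => simp
    | add x y hx hy =>
      simp only [map_add, LinearMap.comp_add, LinearMap.rTensor_add, LinearMap.add_apply, hx, hy,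
        smul_add]
    | tmul v a =>
      rw [← TensorProduct.tmul_smul, ← h]
      generalize (Coalgebra.comul (R := k) u : H ⊗[k] H) = z
      induction z with
      | zero => simp
      | add x y hx hy => simp only [map_add, hx, hy, TensorProduct.tmul_add]
      | tmul b c => simp
  have h2 : ∀ x : W ⊗[k] H, (TensorProduct.lift γ).lTensor V (TensorProduct.assoc k V H H
      (((TensorProduct.lift β).lTensor V ∘ₗ (TensorProduct.assoc k V H H).toLinearMap ∘ₗ
        g.rTensor H).rTensor H ((TensorProduct.assoc k W H H).symm
          ((Coalgebra.comul (R := k) (A := H)).lTensor W x)))) =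
      TensorProduct.rid k (V ⊗[k] H) (g.rTensor k
        ((Coalgebra.counit (R := k) (A := H)).lTensor W x)) := by
    intro x
    induction x with
    | zero => simp
    | add x y hx hy => simp only [map_add, hx, hy]
    | tmul w u =>
      simp only [LinearMap.lTensor_tmul, LinearMap.rTensor_tmul, TensorProduct.rid_tmul]
      rw [← h1]
      congr 2
      generalize (Coalgebra.comul (R := k) u : H ⊗[k] H) = z
      induction z with
      | zero => simp
      | add x y hx hy => simp only [map_add, hx, hy, TensorProduct.tmul_add]
      | tmul b c => simp
  have h3 := h2 (coact w)
  rw [counit_apply, ← coassoc_apply', ← LinearMap.comp_apply, ← LinearMap.rTensor_comp] at h3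
  simpa [twist_apply, twist, LinearMap.comp_assoc] using h3


/-- For `x = ∑ fᵢ ⊗ hᵢ`, the map `w ↦ ∑ fᵢ(w₀) ⊗ γ(hᵢ, w₁)`. -/
def twistedEval (γ : H →ₗ[k] H →ₗ[k] H) : (W →ₗ[k] V) ⊗[k] H →ₗ[k] (W →ₗ[k] V ⊗[k] H) :=
  LinearMap.lcomp k _ (coact (k := k) (H := H)) ∘ₗ
    TensorProduct.map₂ (LinearMap.id : (W →ₗ[k] V) →ₗ[k] (W →ₗ[k] V)) γ

theorem twistedEval_apply (γ : H →ₗ[k] H →ₗ[k] H) (x : (W →ₗ[k] V) ⊗[k] H) (w : W) :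
    twistedEval γ x w =
      TensorProduct.map₂ (LinearMap.id : (W →ₗ[k] V) →ₗ[k] (W →ₗ[k] V)) γ x (coact w) := rfl

theorem twist_homTensor (γ : H →ₗ[k] H →ₗ[k] H) (x : (W →ₗ[k] V) ⊗[k] H) :
    twist γ (homTensor k H W V x) = twistedEval γ x := by
  ext w
  rw [twist_apply, twistedEval_apply]
  generalize (coact w : W ⊗[k] H) = y
  induction x with
  | zero => simp
  | add x x' hx hx' => simp only [map_add, LinearMap.add_apply, LinearMap.rTensor_add, hx, hx']
  | tmul f h =>
    induction y with
    | zero => simp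
    | add x x' hx hx' => simp only [map_add, hx, hx']
    | tmul w u => simp

namespace CoactionTwist

variable (t : CoactionTwist k H)

theorem twist_inv_op (g : W →ₗ[k] V ⊗[k] H) : twist t.inv (twist t.op g) = g :=
  twist_twist _ _ t.inv_op g

theorem twist_op_inv (g : W →ₗ[k] V ⊗[k] H) : twist t.op (twist t.inv g) = g :=
  twist_twist _ _ t.op_inv g

theorem twistedEval_injective :
    Function.Injective (twistedEval (W := W) (V := V) t.inv) := by
  intro x y h
  rw [← twist_homTensor, ← twist_homTensor] at h
  have := congrArg (twist t.op) h
  rw [twist_op_inv, twist_op_inv] at this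
  exact homTensor_injective k H W V this

theorem twistedEval_twistedEval (x : (W →ₗ[k] V) ⊗[k] H) (w : W) :
    twistedEval t.inv ((twistedEval t.inv).rTensor H ((TensorProduct.assoc k (W →ₗ[k] V) H H).symm
      ((Coalgebra.comul (R := k) (A := H)).lTensor (W →ₗ[k] V) x))) w =
    (TensorProduct.assoc k V H H).symm ((Coalgebra.comul (R := k) (A := H)).lTensor V
      (twistedEval t.inv x w)) := by
  induction x with
  | zero => simp
  | add x x' hx hx' => simp only [map_add, LinearMap.add_apply, hx, hx']
  | tmul f h =>
    have h1 : ∀ z : H ⊗[k] H, twistedEval t.inv ((twistedEval t.inv).rTensor H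
        ((TensorProduct.assoc k (W →ₗ[k] V) H H).symm (f ⊗ₜ z))) w =
        (TensorProduct.assoc k V H H).symm (TensorProduct.map f
          (TensorProduct.map₂ t.inv t.inv z)
          ((Coalgebra.comul (R := k) (A := H)).lTensor W (coact w))) := by
      intro z
      induction z with
      | zero => simp
      | add x x' hx hx' =>
        simp only [map_add, TensorProduct.tmul_add, LinearMap.add_apply, hx, hx',
          TensorProduct.map_add_right]
      | tmul a b =>
        rw [← coassoc_apply]
        simp only [TensorProduct.assoc_symm_tmul, LinearMap.rTensor_tmul, twistedEval_apply,
          TensorProduct.map₂_apply_tmul]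
        have h2 : twistedEval t.inv (f ⊗ₜ a) =
          TensorProduct.map f (t.inv a) ∘ₗ coact (k := k) (H := H) := rfl
        have h3 : TensorProduct.map (twistedEval t.inv (f ⊗ₜ a)) (t.inv b) =
            TensorProduct.map (TensorProduct.map f (t.inv a)) (t.inv b) ∘ₗ
              (coact (k := k) (H := H)).rTensor H := by
          rw [h2, LinearMap.rTensor, ← TensorProduct.map_comp, LinearMap.comp_id]
        simp only [LinearMap.id_apply]
        rw [h3, LinearMap.comp_apply]
        generalize (coact (k := k) (H := H)).rTensor H (coact w) = y
        induction y with
        | zero => simp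
        | add x x' hx hx' => simp only [map_add, hx, hx']
        | tmul u d =>
          induction u with
          | zero => simp
          | add x x' hx hx' => simp only [map_add, TensorProduct.add_tmul, hx, hx']
          | tmul w c => simp
    rw [LinearMap.lTensor_tmul, h1]
    congr 1
    rw [twistedEval_apply]
    generalize (coact w : W ⊗[k] H) = y
    induction y with
    | zero => simp
    | add x x' hx hx' => simp only [map_add, hx, hx']
    | tmul w u => simp [t.comul_inv]

theorem twistedEval_rTensor {T : Type*} [AddCommGroup T] [Module k T]
    (φ : T →ₗ[k] W →ₗ[k] V) (y : T ⊗[k] H) (w : W) :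
    twistedEval t.inv (φ.rTensor H y) w = TensorProduct.map₂ φ t.inv y (coact w) := by
  rw [twistedEval_apply]
  generalize (coact w : W ⊗[k] H) = z
  induction y with
  | zero => simp
  | add x x' hx hx' => simp only [map_add, LinearMap.add_apply, hx, hx']
  | tmul f h => simp

variable [RightComodule k H V]

/-- The map `ρ : Hom(W, V) → Hom(W, V ⊗ H)`, `ρ f (w) = f(w₀)₀ ⊗ op (f(w₀)₁) w₁`. -/
def rho : (W →ₗ[k] V) →ₗ[k] (W →ₗ[k] V ⊗[k] H) :=
  twist t.op ∘ₗ LinearMap.compRight k (coact (k := k) (H := H))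

theorem rho_apply (f : W →ₗ[k] V) (w : W) : t.rho f w =
    (TensorProduct.lift t.op).lTensor V (TensorProduct.assoc k V H H
      ((coact (k := k) (H := H) ∘ₗ f).rTensor H (coact w))) := rfl

variable (W V) in
/-- The subspace of those `f ∈ Hom(W, V)` with `ρ f ∈ Hom(W, V) ⊗ H`. -/
def homSub : Submodule k (W →ₗ[k] V) :=
  (LinearMap.range (homTensor k H W V)).comap t.rho

theorem rho_eq_iff (f : W →ₗ[k] V) (x : (W →ₗ[k] V) ⊗[k] H) :
    homTensor k H W V x = t.rho f ↔ twistedEval t.inv x = coact (k := k) (H := H) ∘ₗ f := by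
  rw [← twist_homTensor]
  constructor
  · intro h
    rw [h]
    exact t.twist_inv_op _
  · intro h
    rw [← t.twist_op_inv (homTensor k H W V x), h]
    rfl

theorem mem_homSub (f : W →ₗ[k] V) : f ∈ t.homSub W V ↔
    ∃ x : (W →ₗ[k] V) ⊗[k] H, twistedEval t.inv x = coact (k := k) (H := H) ∘ₗ f := by
  simp only [← rho_eq_iff]
  rfl

theorem twistedEval_rTensor_compRight (γ : H →ₗ[k] H →ₗ[k] H) (x : (W →ₗ[k] V) ⊗[k] H) (w : W) :
    twistedEval γ ((LinearMap.compRight k (M := W) (coact (k := k) (H := H) (V := V))).rTensor H x)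
      w = (coact (k := k) (H := H)).rTensor H (twistedEval γ x w) := by
  simp only [twistedEval_apply]
  generalize (coact w : W ⊗[k] H) = y
  induction x with
  | zero => simp
  | add x x' hx hx' => simp only [map_add, LinearMap.add_apply, hx, hx']
  | tmul f h =>
    induction y with
    | zero => simp
    | add x x' hx hx' => simp only [map_add, hx, hx']
    | tmul w u => simp

/-- The key identity: the coefficients of `ρ f` satisfy coassociativity. -/
theorem rTensor_compRight_eq (f : W →ₗ[k] V) (x : (W →ₗ[k] V) ⊗[k] H)
    (hx : twistedEval t.inv x = coact (k := k) (H := H) ∘ₗ f) :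
    (LinearMap.compRight k (M := W) (coact (k := k) (H := H) (V := V))).rTensor H x =
      (twistedEval t.inv).rTensor H ((TensorProduct.assoc k (W →ₗ[k] V) H H).symm
        ((Coalgebra.comul (R := k) (A := H)).lTensor (W →ₗ[k] V) x)) := by
  apply t.twistedEval_injective
  ext w
  rw [twistedEval_rTensor_compRight, twistedEval_twistedEval, hx, LinearMap.comp_apply,
    coassoc_apply']

theorem exists_coact (f : t.homSub W V) : ∃ y : t.homSub W V ⊗[k] H,
    twistedEval t.inv ((t.homSub W V).subtype.rTensor H y) = coact (k := k) (H := H) ∘ₗ f.1 := by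
  obtain ⟨x, hx⟩ := (t.mem_homSub f.1).1 f.2
  have key := t.rTensor_compRight_eq f.1 x hx
  let q := (LinearMap.range (twistedEval (W := W) (V := V) t.inv)).mkQ ∘ₗ
    LinearMap.compRight k (M := W) (coact (k := k) (H := H) (V := V))
  have hex : Function.Exact (t.homSub W V).subtype q := by
    intro g
    simp only [q, LinearMap.comp_apply, Submodule.mkQ_apply, Submodule.Quotient.mk_eq_zero]
    constructor
    · rintro ⟨x, hx⟩
      exact ⟨⟨g, (t.mem_homSub g).2 ⟨x, hx⟩⟩, rfl⟩
    · rintro ⟨g, rfl⟩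
      exact (t.mem_homSub g.1).1 g.2
  have hex' := Module.Flat.rTensor_exact H hex
  obtain ⟨y, rfl⟩ := (hex' x).1 (by
    simp only [q]
    rw [LinearMap.rTensor_comp, LinearMap.comp_apply, key, ← LinearMap.comp_apply,
      ← LinearMap.rTensor_comp]
    have : (LinearMap.range (twistedEval (W := W) (V := V) t.inv)).mkQ ∘ₗ twistedEval t.inv = 0 :=
      LinearMap.range_mkQ_comp _
    rw [this]
    simp)
  exact ⟨y, hx⟩

theorem subtype_rTensor_injective :
    Function.Injective ((t.homSub W V).subtype.rTensor H) :=
  Module.Flat.rTensor_preserves_injective_linearMap _ Subtype.val_injective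

variable (W V) in
/-- The map `y ↦ twistedEval y` on `homSub ⊗ H`. -/
def evalSub : t.homSub W V ⊗[k] H →ₗ[k] (W →ₗ[k] V ⊗[k] H) :=
  twistedEval t.inv ∘ₗ (t.homSub W V).subtype.rTensor H

theorem evalSub_injective : Function.Injective (t.evalSub W V) :=
  t.twistedEval_injective.comp t.subtype_rTensor_injective

variable (W V) in
/-- The coaction on `homSub`, i.e. `ρ` as a map with values in `homSub ⊗ H`
(see `homTensor_homCoact`). -/
def homCoact : t.homSub W V →ₗ[k] t.homSub W V ⊗[k] H where
  toFun f := (t.exists_coact f).choose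
  map_add' f g := t.evalSub_injective <| by
    rw [map_add]
    refine (t.exists_coact (f + g)).choose_spec.trans ?_
    refine Eq.trans ?_ (congrArg₂ (· + ·) (t.exists_coact f).choose_spec
      (t.exists_coact g).choose_spec).symm
    simp [LinearMap.comp_add]
  map_smul' c f := t.evalSub_injective <| by
    rw [map_smul]
    refine (t.exists_coact (c • f)).choose_spec.trans ?_
    refine Eq.trans ?_ (congrArg (c • ·) (t.exists_coact f).choose_spec).symm
    simp [LinearMap.comp_smul]

theorem evalSub_homCoact (f : t.homSub W V) :
    t.evalSub W V (t.homCoact W V f) = coact (k := k) (H := H) ∘ₗ f.1 :=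
  (t.exists_coact f).choose_spec

theorem homTensor_homCoact (f : t.homSub W V) :
    homTensor k H W V ((t.homSub W V).subtype.rTensor H (t.homCoact W V f)) = t.rho f.1 :=
  (t.rho_eq_iff _ _).2 (t.evalSub_homCoact f)

theorem coact_apply_eq (f : t.homSub W V) (w : W) : coact (f.1 w) =
    TensorProduct.map₂ (t.homSub W V).subtype t.inv (t.homCoact W V f) (coact w) := by
  have h := LinearMap.congr_fun (t.evalSub_homCoact f) w
  rw [LinearMap.comp_apply] at h
  rw [← h, evalSub, LinearMap.comp_apply, twistedEval_apply]
  generalize t.homCoact W V f = y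
  generalize (coact w : W ⊗[k] H) = z
  induction y with
  | zero => simp
  | add x x' hx hx' => simp only [map_add, LinearMap.add_apply, hx, hx']
  | tmul f h => simp

instance homComodule : RightComodule k H (t.homSub W V) where
  coact := t.homCoact W V
  coassoc := by
    ext1 f
    simp only [LinearMap.comp_apply, LinearEquiv.coe_coe]
    rw [← LinearEquiv.eq_symm_apply]
    have inj := Module.Flat.rTensor_preserves_injective_linearMap (M := H) _
      (t.evalSub_injective (W := W) (V := V))
    apply inj
    rw [← LinearMap.comp_apply, ← LinearMap.rTensor_comp]
    have h1 : t.evalSub W V ∘ₗ t.homCoact W V =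
        LinearMap.compRight k (M := W) (coact (k := k) (H := H) (V := V)) ∘ₗ
          (t.homSub W V).subtype := by
      ext1 f
      exact t.evalSub_homCoact f
    rw [h1, LinearMap.rTensor_comp, LinearMap.comp_apply,
      t.rTensor_compRight_eq f.1 _ (t.evalSub_homCoact f), evalSub, LinearMap.rTensor_comp,
      LinearMap.comp_apply]
    congr 1
    generalize t.homCoact W V f = y
    induction y with
    | zero => simp
    | add x x' hx hx' => simp only [map_add, hx, hx']
    | tmul g u =>
      simp only [LinearMap.rTensor_tmul, LinearMap.lTensor_tmul]
      generalize (Coalgebra.comul (R := k) u : H ⊗[k] H) = z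
      induction z with
      | zero => simp
      | add x x' hx hx' => simp only [map_add, TensorProduct.tmul_add, hx, hx']
      | tmul a b => simp
  lTensor_counit_comp_coact := by
    ext1 f
    simp only [LinearMap.comp_apply, LinearMap.flip_apply, TensorProduct.mk_apply]
    have h1 : TensorProduct.rid k _ ((Coalgebra.counit (R := k) (A := H)).lTensor
        (t.homSub W V) (t.homCoact W V f)) = f := by
      apply Subtype.ext
      ext w
      have h2 := congrArg (fun z => TensorProduct.rid k V
        ((Coalgebra.counit (R := k) (A := H)).lTensor V z)) (t.coact_apply_eq f w)
      rw [counit_apply, TensorProduct.rid_tmul, one_smul] at h2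
      rw [h2]
      have h3 : ∀ (y : t.homSub W V ⊗[k] H) (z : W ⊗[k] H),
          TensorProduct.rid k V ((Coalgebra.counit (R := k) (A := H)).lTensor V
            (TensorProduct.map₂ (t.homSub W V).subtype t.inv y z)) =
          (TensorProduct.rid k _ ((Coalgebra.counit (R := k) (A := H)).lTensor
            (t.homSub W V) y)).1
              (TensorProduct.rid k _ ((Coalgebra.counit (R := k) (A := H)).lTensor W z)) := by
        intro y z
        induction y with
        | zero => simp
        | add x x' hx hx' =>
          simp only [map_add, LinearMap.add_apply, hx, hx', Submodule.coe_add]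
        | tmul g a =>
          induction z with
          | zero => simp
          | add x x' hx hx' => simp only [map_add, hx, hx']
          | tmul w b =>
            simp only [TensorProduct.map₂_apply_tmul, TensorProduct.map_tmul,
              LinearMap.lTensor_tmul, TensorProduct.rid_tmul, t.counit_inv, mul_smul,
              Submodule.subtype_apply, Submodule.coe_smul, LinearMap.smul_apply, map_smul]
            exact smul_comm _ _ _
      rw [h3, counit_apply, TensorProduct.rid_tmul, one_smul]
    exact (TensorProduct.rid k _).injective (by rw [h1]; simp)

theorem coact_hom_apply (f : t.homSub W V) (w : W) : coact (f.1 w) =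
    TensorProduct.map₂ (t.homSub W V).subtype t.inv (coact f) (coact w) :=
  t.coact_apply_eq f w

section Lift

variable {T : Type*} [AddCommGroup T] [Module k T] (δ : T →ₗ[k] T ⊗[k] H)
  (φ : T →ₗ[k] W →ₗ[k] V)
  (hφ : ∀ x w, coact (φ x w) = TensorProduct.map₂ φ t.inv (δ x) (coact w))

theorem mem_of_coact (hφ : ∀ x w, coact (φ x w) = TensorProduct.map₂ φ t.inv (δ x) (coact w))
    (x : T) : φ x ∈ t.homSub W V := by
  rw [mem_homSub]
  refine ⟨φ.rTensor H (δ x), ?_⟩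
  ext w
  rw [twistedEval_rTensor, LinearMap.comp_apply, hφ]

/-- A family of linear maps with the right coaction factors through `homSub`. -/
def liftSub : T →ₗ[k] t.homSub W V :=
  φ.codRestrict (t.homSub W V) (t.mem_of_coact δ φ hφ)

theorem coact_liftSub (x : T) : coact (t.liftSub δ φ hφ x) =
    (t.liftSub δ φ hφ).rTensor H (δ x) := by
  apply t.evalSub_injective
  refine (t.evalSub_homCoact _).trans ?_
  ext w
  rw [evalSub, LinearMap.comp_apply, LinearMap.comp_apply, ← LinearMap.rTensor_comp_apply,
    twistedEval_rTensor]
  exact hφ x w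

end Lift

end CoactionTwist

end Twist

/-! ## Hopf algebras with bijective antipode and the two internal Homs -/

section Hopf

/-- The antipode `S` of the Hopf algebra `H` is invertible. -/
class HasBijectiveAntipode (k H : Type*) [Field k] [Ring H] [HopfAlgebra k H] : Prop where
  bijective : Function.Bijective (HopfAlgebra.antipode k (A := H))

variable (k H : Type*) [Field k] [Ring H] [HopfAlgebra k H]

/-- The inverse `S⁻¹` of the antipode. -/
def antipodeInv [HasBijectiveAntipode k H] : H →ₗ[k] H :=
  (LinearEquiv.ofBijective (HopfAlgebra.antipode k (A := H))
    HasBijectiveAntipode.bijective).symm.toLinearMap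

variable {k H}

theorem antipode_antipodeInv [HasBijectiveAntipode k H] (h : H) :
    HopfAlgebra.antipode k (antipodeInv k H h) = h :=
  (LinearEquiv.ofBijective (HopfAlgebra.antipode k (A := H))
    HasBijectiveAntipode.bijective).apply_symm_apply h

theorem antipodeInv_mul (h : H) [HasBijectiveAntipode k H] :
    LinearMap.mul' k H (TensorProduct.comm k H H ((antipodeInv k H).lTensor H
      (Coalgebra.comul (R := k) h))) = Coalgebra.counit (R := k) h • (1 : H) := by
  apply (HasBijectiveAntipode.bijective (k := k) (H := H)).1
  rw [map_smul, HopfAlgebra.antipode_one, ← Algebra.algebraMap_eq_smul_one,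
    ← HopfAlgebra.mul_antipode_rTensor_comul_apply]
  generalize (Coalgebra.comul (R := k) h : H ⊗[k] H) = z
  induction z with
  | zero => simp
  | add x x' hx hx' => simp only [map_add, hx, hx']
  | tmul a b => simp [HopfAlgebra.antipode_mul_antidistrib, antipode_antipodeInv]

theorem mul_antipodeInv (h : H) [HasBijectiveAntipode k H] :
    LinearMap.mul' k H (TensorProduct.comm k H H ((antipodeInv k H).rTensor H
      (Coalgebra.comul (R := k) h))) = Coalgebra.counit (R := k) h • (1 : H) := by
  apply (HasBijectiveAntipode.bijective (k := k) (H := H)).1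
  rw [map_smul, HopfAlgebra.antipode_one, ← Algebra.algebraMap_eq_smul_one,
    ← HopfAlgebra.mul_antipode_lTensor_comul_apply]
  generalize (Coalgebra.comul (R := k) h : H ⊗[k] H) = z
  induction z with
  | zero => simp
  | add x x' hx hx' => simp only [map_add, hx, hx']
  | tmul a b => simp [HopfAlgebra.antipode_mul_antidistrib, antipode_antipodeInv]

theorem comul_mul_eq (a h : H) : Coalgebra.comul (R := k) (a * h) =
    TensorProduct.map₂ (LinearMap.mul k H) (LinearMap.mul k H)
      (Coalgebra.comul (R := k) a) (Coalgebra.comul (R := k) h) := by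
  rw [Bialgebra.comul_mul]
  generalize (Coalgebra.comul (R := k) a : H ⊗[k] H) = y
  generalize (Coalgebra.comul (R := k) h : H ⊗[k] H) = z
  induction y with
  | zero => simp
  | add x x' hx hx' => simp only [map_add, add_mul, LinearMap.add_apply, hx, hx']
  | tmul a b =>
    induction z with
    | zero => simp
    | add x x' hx hx' => simp only [map_add, mul_add, hx, hx']
    | tmul c d => simp

variable (k H)

/-- `op a h = a * S h`: the coaction is `ρ f (w) = f(w₀)₀ ⊗ f(w₀)₁ S(w₁)`. -/
def leftTwist : CoactionTwist k H where
  op := (LinearMap.mul k H).compl₂ (HopfAlgebra.antipode k)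
  inv := LinearMap.mul k H
  inv_op a h := by
    have := HopfAlgebra.mul_antipode_rTensor_comul_apply (R := k) h
    rw [Algebra.algebraMap_eq_smul_one] at this
    rw [← mul_one a, ← mul_smul_comm, ← this]
    generalize (Coalgebra.comul (R := k) h : H ⊗[k] H) = z
    induction z with
    | zero => simp
    | add x x' hx hx' => simp only [map_add, mul_add, hx, hx']
    | tmul c d => simp [mul_assoc]
  op_inv a h := by
    have := HopfAlgebra.mul_antipode_lTensor_comul_apply (R := k) h
    rw [Algebra.algebraMap_eq_smul_one] at this
    rw [← mul_one a, ← mul_smul_comm, ← this]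
    generalize (Coalgebra.comul (R := k) h : H ⊗[k] H) = z
    induction z with
    | zero => simp
    | add x x' hx hx' => simp only [map_add, mul_add, hx, hx']
    | tmul c d => simp [mul_assoc]
  comul_inv a h := comul_mul_eq a h
  counit_inv a h := by simp

/-- `op a h = S⁻¹ h * a`: the coaction is `ρ f (w) = f(w₀)₀ ⊗ S⁻¹(w₁) f(w₀)₁`. -/
def rightTwist [HasBijectiveAntipode k H] : CoactionTwist k H where
  op := ((LinearMap.mul k H) ∘ₗ antipodeInv k H).flip
  inv := (LinearMap.mul k H).flip
  inv_op a h := by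
    rw [← one_mul a, ← smul_mul_assoc, ← mul_antipodeInv]
    generalize (Coalgebra.comul (R := k) h : H ⊗[k] H) = z
    induction z with
    | zero => simp
    | add x x' hx hx' => simp only [map_add, add_mul, hx, hx']
    | tmul c d => simp [mul_assoc]
  op_inv a h := by
    rw [← one_mul a, ← smul_mul_assoc, ← antipodeInv_mul]
    generalize (Coalgebra.comul (R := k) h : H ⊗[k] H) = z
    induction z with
    | zero => simp
    | add x x' hx hx' => simp only [map_add, add_mul, hx, hx']
    | tmul c d => simp [mul_assoc]
  comul_inv a h := by
    rw [LinearMap.flip_apply, LinearMap.mul_apply', comul_mul_eq]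
    generalize (Coalgebra.comul (R := k) a : H ⊗[k] H) = y
    generalize (Coalgebra.comul (R := k) h : H ⊗[k] H) = z
    induction y with
    | zero => simp
    | add x x' hx hx' => simp only [map_add, LinearMap.add_apply, hx, hx']
    | tmul a b =>
      induction z with
      | zero => simp
      | add x x' hx hx' => simp only [map_add, LinearMap.add_apply, hx, hx']
      | tmul c d => simp
  counit_inv a h := by simp [mul_comm]

end Hopf

/-! ## The monoidal category of right comodules -/

/-- The category `𝓜^H` of right `H`-comodules. -/
structure Comod (k H : Type u) [Field k] [Ring H] [HopfAlgebra k H] where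
  /-- The underlying vector space. -/
  carrier : Type u
  [addCommGroup : AddCommGroup carrier]
  [module : Module k carrier]
  [comodule : RightComodule k H carrier]

namespace Comod

attribute [instance] addCommGroup module comodule

variable {k H : Type u} [Field k] [Ring H] [HopfAlgebra k H]

instance : CoeSort (Comod k H) (Type u) := ⟨carrier⟩

/-- A morphism of comodules: a linear map `f` with `f(v)₀ ⊗ f(v)₁ = f(v₀) ⊗ v₁`. -/
@[ext]
structure Hom (V W : Comod k H) where
  /-- The underlying linear map. -/
  lin : V →ₗ[k] W
  coact_lin : ∀ v : V, (coact (lin v) : W ⊗[k] H) = lin.rTensor H (coact v)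

instance : Category (Comod k H) where
  Hom := Hom
  id V := { lin := LinearMap.id, coact_lin := by simp }
  comp f g :=
    { lin := g.lin ∘ₗ f.lin
      coact_lin := fun v => by
        rw [LinearMap.rTensor_comp_apply, ← f.coact_lin, ← g.coact_lin, LinearMap.comp_apply] }

/-- The underlying linear map of a morphism. -/
abbrev toLin {V W : Comod k H} (f : V ⟶ W) : V →ₗ[k] W := Hom.lin f

theorem hom_ext {V W : Comod k H} {f g : V ⟶ W} (h : ∀ v, toLin f v = toLin g v) : f = g :=
  Hom.ext (LinearMap.ext h)

theorem coact_toLin {V W : Comod k H} (f : V ⟶ W) (v : V) :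
    (coact (toLin f v) : W ⊗[k] H) = (toLin f).rTensor H (coact v) := Hom.coact_lin f v

@[simp]
theorem toLin_id (V : Comod k H) : toLin (𝟙 V) = LinearMap.id := rfl

@[simp]
theorem toLin_comp {U V W : Comod k H} (f : U ⟶ V) (g : V ⟶ W) :
    toLin (f ≫ g) = toLin g ∘ₗ toLin f := rfl

/-- An invertible linear map that is a morphism of comodules is an isomorphism. -/
def isoMk {V W : Comod k H} (e : V ≃ₗ[k] W)
    (h : ∀ v : V, (coact (e v) : W ⊗[k] H) = e.toLinearMap.rTensor H (coact v)) : V ≅ W where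
  hom := { lin := e.toLinearMap, coact_lin := h }
  inv :=
    { lin := e.symm.toLinearMap
      coact_lin := fun w => by
        obtain ⟨v, rfl⟩ := e.surjective w
        rw [h, ← LinearMap.rTensor_comp_apply]
        simp }
  hom_inv_id := hom_ext fun v => e.symm_apply_apply v
  inv_hom_id := hom_ext fun v => e.apply_symm_apply v

section Tensor

/-- The tensor product of two morphisms. -/
def tensorHom {V V' W W' : Comod k H} (f : V ⟶ V') (g : W ⟶ W') :
    (⟨V ⊗[k] W⟩ : Comod k H) ⟶ (⟨V' ⊗[k] W'⟩ : Comod k H) where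
  lin := TensorProduct.map (toLin f) (toLin g)
  coact_lin x := by
    dsimp only at x ⊢
    induction x with
    | zero => simp
    | add x x' hx hx' => simp only [map_add, hx, hx']
    | tmul v w =>
      rw [TensorProduct.map_tmul, coact_tmul, coact_tmul, coact_toLin, coact_toLin]
      generalize (coact v : V ⊗[k] H) = y
      generalize (coact w : W ⊗[k] H) = z
      induction y with
      | zero => simp
      | add x x' hx hx' => simp only [map_add, LinearMap.add_apply, hx, hx']
      | tmul a b =>
        induction z with
        | zero => simp
        | add x x' hx hx' => simp only [map_add, hx, hx']
        | tmul c d => simp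

/-- The associativity isomorphism `(U ⊗ V) ⊗ W ≅ U ⊗ (V ⊗ W)`. -/
def associator (U V W : Comod k H) :
    (⟨(U ⊗[k] V) ⊗[k] W⟩ : Comod k H) ≅ ⟨U ⊗[k] (V ⊗[k] W)⟩ :=
  isoMk (V := ⟨(U ⊗[k] V) ⊗[k] W⟩) (W := ⟨U ⊗[k] (V ⊗[k] W)⟩) (TensorProduct.assoc k U V W) <| by
    intro x
    dsimp only at x ⊢
    induction x with
    | zero => simp
    | add x x' hx hx' => simp only [map_add, hx, hx']
    | tmul x w =>
      induction x with
      | zero => simp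
      | add x x' hx hx' => simp only [TensorProduct.add_tmul, map_add, hx, hx']
      | tmul u v =>
        rw [TensorProduct.assoc_tmul, coact_tmul, coact_tmul, coact_tmul, coact_tmul]
        generalize (coact u : U ⊗[k] H) = y
        generalize (coact v : V ⊗[k] H) = z
        generalize (coact w : W ⊗[k] H) = t
        induction y with
        | zero => simp
        | add x x' hx hx' => simp only [map_add, LinearMap.add_apply, hx, hx']
        | tmul a b =>
          induction z with
          | zero => simp
          | add x x' hx hx' => simp only [map_add, LinearMap.add_apply, hx, hx']
          | tmul c d =>
            induction t with
            | zero => simp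
            | add x x' hx hx' => simp only [map_add, hx, hx']
            | tmul e f => simp [mul_assoc]

/-- The left unit isomorphism `k ⊗ V ≅ V`. -/
def leftUnitor (V : Comod k H) : (⟨k ⊗[k] V⟩ : Comod k H) ≅ V :=
  isoMk (V := ⟨k ⊗[k] V⟩) (TensorProduct.lid k V) <| by
    intro x
    dsimp only at x ⊢
    induction x with
    | zero => simp
    | add x x' hx hx' => simp only [map_add, hx, hx']
    | tmul c v =>
      rw [TensorProduct.lid_tmul, coact_tmul, map_smul, coact_unit]
      generalize (coact v : V ⊗[k] H) = y
      induction y with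
      | zero => simp
      | add x x' hx hx' => simp only [map_add, smul_add, hx, hx']
      | tmul a b => simp [TensorProduct.smul_tmul']

/-- The right unit isomorphism `V ⊗ k ≅ V`. -/
def rightUnitor (V : Comod k H) : (⟨V ⊗[k] k⟩ : Comod k H) ≅ V :=
  isoMk (V := ⟨V ⊗[k] k⟩) (TensorProduct.rid k V) <| by
    intro x
    dsimp only at x ⊢
    induction x with
    | zero => simp
    | add x x' hx hx' => simp only [map_add, hx, hx']
    | tmul v c =>
      rw [TensorProduct.rid_tmul, coact_tmul, map_smul, coact_unit]
      generalize (coact v : V ⊗[k] H) = y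
      induction y with
      | zero => simp
      | add x x' hx hx' => simp only [map_add, LinearMap.add_apply, smul_add, hx, hx']
      | tmul a b => simp [TensorProduct.smul_tmul']

/-- The monoidal structure of `𝓜^H`: `V ⊗ W` has the coaction `v₀ ⊗ w₀ ⊗ v₁ w₁`. -/
instance : MonoidalCategoryStruct (Comod k H) where
  tensorObj V W := ⟨V ⊗[k] W⟩
  whiskerLeft V _ _ g := tensorHom (𝟙 V) g
  whiskerRight f W := tensorHom f (𝟙 W)
  tensorHom f g := tensorHom f g
  tensorUnit := ⟨k⟩
  associator := associator
  leftUnitor := leftUnitor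
  rightUnitor := rightUnitor

theorem tensor_hom_ext {U V W : Comod k H} {f g : (⟨U ⊗[k] V⟩ : Comod k H) ⟶ W}
    (h : ∀ (u : U) (v : V), toLin f (u ⊗ₜ v) = toLin g (u ⊗ₜ v)) : f = g :=
  Hom.ext (TensorProduct.ext' h)

open MonoidalCategory

instance : MonoidalCategory (Comod k H) where
  tensorHom_def f g := tensor_hom_ext fun _ _ => rfl
  id_tensorHom_id U V := tensor_hom_ext fun _ _ => rfl
  tensorHom_comp_tensorHom f g f' g' := tensor_hom_ext fun _ _ => rfl
  whiskerLeft_id U V := tensor_hom_ext fun _ _ => rfl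
  id_whiskerRight U V := tensor_hom_ext fun _ _ => rfl
  associator_naturality f g h := Hom.ext (TensorProduct.ext_threefold fun _ _ _ => rfl)
  leftUnitor_naturality f := tensor_hom_ext fun c v => by
    exact ((toLin f).map_smul c v).symm
  rightUnitor_naturality f := tensor_hom_ext fun v c => by
    exact ((toLin f).map_smul c v).symm
  pentagon U V W X := Hom.ext (TensorProduct.ext_fourfold fun _ _ _ _ => rfl)
  triangle U V := Hom.ext (TensorProduct.ext_threefold fun u c v =>
    (TensorProduct.smul_tmul c u v).symm)

end Tensor

end Comod

/-! ## Bimodule categories and their centers -/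

section Center

open MonoidalCategory MonoidalLeftAction MonoidalRightAction

/-- A bimodule category `D` over a monoidal category `C`: a left action `c ▷ d` and a right
action `d ◁ c` together with coherent natural isomorphisms `(c ▷ d) ◁ c' ≅ c ▷ (d ◁ c')`. -/
class BimoduleCategory (C : Type u₁) [Category.{v₁} C] [MonoidalCategory C]
    (D : Type u₂) [Category.{v₂} D] [MonoidalLeftAction C D] [MonoidalRightAction C D] where
  /-- The isomorphism `(c ▷ d) ◁ c' ≅ c ▷ (d ◁ c')`. -/
  midIso (c : C) (d : D) (c' : C) : (c ⊙ₗ d : D) ⊙ᵣ c' ≅ c ⊙ₗ (d ⊙ᵣ c' : D)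
  midIso_naturality {c₁ c₂ : C} {d₁ d₂ : D} {e₁ e₂ : C} (f : c₁ ⟶ c₂) (g : d₁ ⟶ d₂)
    (h : e₁ ⟶ e₂) :
    ((f ⊙ₗₘ g) ⊙ᵣₘ h) ≫ (midIso c₂ d₂ e₂).hom = (midIso c₁ d₁ e₁).hom ≫ (f ⊙ₗₘ (g ⊙ᵣₘ h))
  midIso_tensor_left (c c' : C) (d : D) (e : C) :
    (midIso (c ⊗ c') d e).hom ≫ (αₗ c c' (d ⊙ᵣ e)).hom =
      (αₗ c c' d).hom ⊵ᵣ e ≫ (midIso c (c' ⊙ₗ d) e).hom ≫ c ⊴ₗ (midIso c' d e).hom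
  midIso_tensor_right (c : C) (d : D) (e e' : C) :
    (midIso c d (e ⊗ e')).hom ≫ c ⊴ₗ (αᵣ d e e').hom =
      (αᵣ (c ⊙ₗ d) e e').hom ≫ (midIso c d e).hom ⊵ᵣ e' ≫ (midIso c (d ⊙ᵣ e) e').hom
  midIso_unit_left (d : D) (e : C) :
    (midIso (𝟙_ C) d e).hom ≫ (λₗ (d ⊙ᵣ e)).hom = (λₗ d).hom ⊵ᵣ e
  midIso_unit_right (c : C) (d : D) :
    (midIso c d (𝟙_ C)).hom ≫ c ⊴ₗ (ρᵣ d).hom = (ρᵣ (c ⊙ₗ d)).hom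

variable (C : Type u₁) [Category.{v₁} C] [MonoidalCategory C]
  (D : Type u₂) [Category.{v₂} D] [MonoidalLeftAction C D] [MonoidalRightAction C D]
  [BimoduleCategory C D]

/-- A central structure on an object `X` of a bimodule category: natural isomorphisms
`c ▷ X ≅ X ◁ c` compatible with tensor products and with the unit. -/
structure CentralStructure (X : D) where
  /-- The isomorphisms `c ▷ X ≅ X ◁ c`. -/
  τ (c : C) : (c ⊙ₗ X : D) ≅ X ⊙ᵣ c
  naturality {c c' : C} (f : c ⟶ c') : f ⊵ₗ X ≫ (τ c').hom = (τ c).hom ≫ X ⊴ᵣ f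
  tensor (c c' : C) : (τ (c ⊗ c')).hom ≫ (αᵣ X c c').hom =
    (αₗ c c' X).hom ≫ c ⊴ₗ (τ c').hom ≫ (BimoduleCategory.midIso c X c').inv ≫
      (τ c).hom ⊵ᵣ c'
  unit : (τ (𝟙_ C)).hom ≫ (ρᵣ X).hom = (λₗ X).hom

/-- The center `𝓩_C(D)` of a bimodule category `D` over `C`: its objects are the objects of `D`
with a central structure. -/
structure BimoduleCenter where
  /-- The underlying object. -/
  obj : D
  /-- The central structure. -/
  central : CentralStructure C D obj

namespace BimoduleCenter

variable {C D}

/-- A morphism in the center is a morphism of `D` that commutes with the central structures. -/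
@[ext]
structure Hom (X Y : BimoduleCenter C D) where
  /-- The underlying morphism. -/
  f : X.obj ⟶ Y.obj
  comm (c : C) : c ⊴ₗ f ≫ (Y.central.τ c).hom = (X.central.τ c).hom ≫ f ⊵ᵣ c

instance : Category (BimoduleCenter C D) where
  Hom := Hom
  id X := { f := 𝟙 X.obj, comm := fun c => by simp }
  comp f g :=
    { f := f.f ≫ g.f
      comm := fun c => by
        rw [MonoidalLeftAction.actionHomRight_comp, Category.assoc, g.comm, ← Category.assoc, f.comm,
          Category.assoc, MonoidalRightAction.comp_actionHomLeft] }
  id_comp f := Hom.ext (Category.id_comp _)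
  comp_id f := Hom.ext (Category.comp_id _)
  assoc f g h := Hom.ext (Category.assoc _ _ _)

variable (C D)

/-- The forgetful functor from the center of `D` to `D`. -/
def forget : BimoduleCenter C D ⥤ D where
  obj X := X.obj
  map f := Hom.f f

end BimoduleCenter

end Center

/-! ## Internal Homs of comodules -/

namespace Comod

open MonoidalCategory

variable {k H : Type u} [Field k] [Ring H] [HopfAlgebra k H]

section Generic

variable (t t₁ t₂ : CoactionTwist k H)

/-- The comodule `homSub W V` attached to a twist. -/
def ihom (W V : Comod k H) : Comod k H := ⟨t.homSub W V⟩

/-- The underlying linear map of an element of `ihom t W V`. -/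
def ihomVal (W V : Comod k H) : ihom t W V →ₗ[k] (W →ₗ[k] V) := (t.homSub W V).subtype

theorem ihomVal_injective (W V : Comod k H) : Function.Injective (ihomVal t W V) :=
  Subtype.val_injective

theorem coact_ihomVal {W V : Comod k H} (f : ihom t W V) (w : W) :
    (coact (ihomVal t W V f w) : V ⊗[k] H) =
      TensorProduct.map₂ (ihomVal t W V) t.inv (coact f) (coact w) :=
  t.coact_hom_apply f w

/-- A bilinear map with the right coaction defines a morphism to `ihom`. -/
def toIhom {T W V : Comod k H} (φ : T →ₗ[k] W →ₗ[k] V)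
    (hφ : ∀ x w, (coact (φ x w) : V ⊗[k] H) =
      TensorProduct.map₂ φ t.inv (coact x) (coact w)) : T ⟶ ihom t W V where
  lin := t.liftSub (coact (k := k) (H := H)) φ hφ
  coact_lin x := t.coact_liftSub _ φ hφ x

theorem ihomVal_toIhom {T W V : Comod k H} (φ : T →ₗ[k] W →ₗ[k] V)
    (hφ : ∀ x w, (coact (φ x w) : V ⊗[k] H) =
      TensorProduct.map₂ φ t.inv (coact x) (coact w)) (x : T) :
    ihomVal t W V (toLin (toIhom t φ hφ) x) = φ x := rfl

theorem to_ihom_ext {T W V : Comod k H} {f g : T ⟶ ihom t W V}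
    (h : ∀ x, ihomVal t W V (toLin f x) = ihomVal t W V (toLin g x)) : f = g :=
  hom_ext fun x => ihomVal_injective t W V (h x)

/-- Functoriality of `ihom`: `f ↦ θ ∘ f ∘ φ`. -/
def ihomMap {W W' V V' : Comod k H} (φ : W' ⟶ W) (θ : V ⟶ V') : ihom t W V ⟶ ihom t W' V' :=
  toIhom t (LinearMap.lcomp k V' (toLin φ) ∘ₗ LinearMap.compRight k (toLin θ) ∘ₗ ihomVal t W V) <| by
    intro f w
    change coact (toLin θ (ihomVal t W V f (toLin φ w))) = _
    rw [coact_toLin, coact_ihomVal, coact_toLin]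
    generalize (coact f : ihom t W V ⊗[k] H) = y
    generalize (coact w : W' ⊗[k] H) = z
    induction y with
    | zero => simp
    | add x x' hx hx' => simp only [map_add, LinearMap.add_apply, hx, hx']
    | tmul a b =>
      induction z with
      | zero => simp
      | add x x' hx hx' => simp only [map_add, hx, hx']
      | tmul c d => simp

/-- The map `x ⊗ w ↦ (x₀ ⊗ w₀) ⊗ inv x₁ w₁`. -/
def pairCoact (T W : Comod k H) : T ⊗[k] W →ₗ[k] (T ⊗[k] W) ⊗[k] H :=
  TensorProduct.lift ((TensorProduct.map₂ (TensorProduct.mk k T W) t₁.inv).compl₁₂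
    (coact (k := k) (H := H)) (coact (k := k) (H := H)))

theorem pairCoact_tmul {T W : Comod k H} (x : T) (w : W) : pairCoact t₁ T W (x ⊗ₜ w) =
    TensorProduct.map₂ (TensorProduct.mk k T W) t₁.inv (coact x) (coact w) := rfl

theorem coact_lift_apply {T W W' V : Comod k H} (φ : T →ₗ[k] W →ₗ[k] W' →ₗ[k] V)
    (hφ : ∀ x w w', (coact (φ x w w') : V ⊗[k] H) = TensorProduct.map₂ (TensorProduct.lift φ)
      t₂.inv (TensorProduct.map₂ (TensorProduct.mk k T W) t₁.inv (coact x) (coact w))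
        (coact w')) (x : T ⊗[k] W) (w' : W') :
    (coact (TensorProduct.lift φ x w') : V ⊗[k] H) =
      TensorProduct.map₂ (TensorProduct.lift φ) t₂.inv (pairCoact t₁ T W x) (coact w') := by
  induction x with
  | zero => simp
  | add x x' hx hx' => simp only [map_add, LinearMap.add_apply, hx, hx']
  | tmul x w => simp [hφ, pairCoact]

/-- A trilinear map with the right coaction defines a morphism to an iterated `ihom`. -/
def toIhom₂ {T W W' V : Comod k H} (φ : T →ₗ[k] W →ₗ[k] W' →ₗ[k] V)
    (hφ : ∀ x w w', (coact (φ x w w') : V ⊗[k] H) = TensorProduct.map₂ (TensorProduct.lift φ)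
      t₂.inv (TensorProduct.map₂ (TensorProduct.mk k T W) t₁.inv (coact x) (coact w))
        (coact w')) : T ⟶ ihom t₁ W (ihom t₂ W' V) :=
  toIhom t₁ (V := ihom t₂ W' V) (TensorProduct.curry (t₂.liftSub (pairCoact t₁ T W)
    (TensorProduct.lift φ) (coact_lift_apply t₁ t₂ φ hφ))) <| by
    intro x w
    refine (t₂.coact_liftSub (pairCoact t₁ T W) (TensorProduct.lift φ)
      (coact_lift_apply t₁ t₂ φ hφ) (x ⊗ₜ w)).trans ?_
    refine (congrArg _ (pairCoact_tmul t₁ x w)).trans ?_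
    generalize (coact x : T ⊗[k] H) = y
    generalize (coact w : W ⊗[k] H) = z
    induction y with
    | zero => simp; rfl
    | add x x' hx hx' => simp only [map_add, LinearMap.add_apply, hx, hx']; rfl
    | tmul a b =>
      induction z with
      | zero => simp; rfl
      | add x x' hx hx' => simp only [map_add, hx, hx']; rfl
      | tmul c d => rfl

/-- The isomorphism `Hom(k, V) ≅ V`. -/
def ihomUnit (h : ∀ a, t.inv a 1 = a) (V : Comod k H) : ihom t (𝟙_ (Comod k H)) V ≅ V where
  hom :=
    { lin := (LinearMap.applyₗ (1 : k)) ∘ₗ ihomVal t (𝟙_ (Comod k H)) V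
      coact_lin := fun f => by
        refine (coact_ihomVal t f (1 : k)).trans ?_
        rw [show (coact (1 : k) : k ⊗[k] H) = 1 ⊗ₜ 1 from rfl]
        generalize (coact f : ihom t (𝟙_ (Comod k H)) V ⊗[k] H) = y
        induction y with
        | zero => simp
        | add x x' hx hx' => simp only [map_add, LinearMap.add_apply, hx, hx']
        | tmul a b =>
          simp only [TensorProduct.map₂_apply_tmul]
          refine (TensorProduct.map_tmul _ _ _ _).trans ?_
          rw [h]
          rfl }
  inv := toIhom t (W := 𝟙_ (Comod k H)) (LinearMap.lsmul k V).flip <| by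
    intro v c
    rw [show (coact c : k ⊗[k] H) = c ⊗ₜ 1 from rfl]
    change coact ((c : k) • v) = _
    rw [map_smul]
    generalize (coact v : V ⊗[k] H) = y
    induction y with
    | zero => simp
    | add x x' hx hx' => simp only [map_add, smul_add, LinearMap.add_apply, hx, hx']
    | tmul a b =>
      simp only [TensorProduct.map₂_apply_tmul]
      refine Eq.trans ?_ (TensorProduct.map_tmul _ _ _ _).symm
      rw [h]
      rfl
  hom_inv_id := to_ihom_ext t fun f => by
    refine LinearMap.ext_ring ?_
    exact one_smul k _
  inv_hom_id := hom_ext fun v => one_smul k v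

/-- Exchanging the two arguments: `Hom(V, Hom(W, M)) → Hom(W, Hom(V, M))`. -/
def ihomFlip (h : ∀ a b c, t₂.inv (t₁.inv a b) c = t₁.inv (t₂.inv a c) b) (V W M : Comod k H) :
    ihom t₁ V (ihom t₂ W M) ⟶ ihom t₂ W (ihom t₁ V M) :=
  toIhom₂ t₂ t₁ (LinearMap.lflip.toLinearMap ∘ₗ LinearMap.compRight k (ihomVal t₂ W M) ∘ₗ
      ihomVal t₁ V (ihom t₂ W M)) <| by
    intro F w v
    change coact (ihomVal t₂ W M (ihomVal t₁ V (ihom t₂ W M) F v) w) = _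
    rw [coact_ihomVal, coact_ihomVal]
    generalize (coact F : ihom t₁ V (ihom t₂ W M) ⊗[k] H) = y
    generalize (coact v : V ⊗[k] H) = z
    generalize (coact w : W ⊗[k] H) = x
    induction y with
    | zero => simp
    | add x x' hx hx' => simp only [map_add, LinearMap.add_apply, hx, hx']
    | tmul a b =>
      induction z with
      | zero => simp
      | add x x' hx hx' => simp only [map_add, LinearMap.add_apply, hx, hx']
      | tmul c d =>
        induction x with
        | zero => simp
        | add x x' hx hx' => simp only [map_add, LinearMap.add_apply, hx, hx']
        | tmul e f => simp [h]

/-- The isomorphism `Hom(V, Hom(W, M)) ≅ Hom(W, Hom(V, M))`. -/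
def ihomFlipIso (h : ∀ a b c, t₂.inv (t₁.inv a b) c = t₁.inv (t₂.inv a c) b)
    (V W M : Comod k H) : ihom t₁ V (ihom t₂ W M) ≅ ihom t₂ W (ihom t₁ V M) where
  hom := ihomFlip t₁ t₂ h V W M
  inv := ihomFlip t₂ t₁ (fun a b c => (h a c b).symm) W V M
  hom_inv_id := hom_ext fun _ => rfl
  inv_hom_id := hom_ext fun _ => rfl

end Generic

end Comod

namespace Comod

open MonoidalCategory

variable {k H : Type u} [Field k] [Ring H] [HopfAlgebra k H]

section Left

/-- The left internal Hom `Hom^l(W, V)`: the subspace of those `f ∈ Hom(W, V)` with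
`ρ f ∈ Hom(W, V) ⊗ H`, where `ρ f (w) = f(w₀)₀ ⊗ f(w₀)₁ S(w₁)`, with the coaction `ρ`. -/
abbrev homL (W V : Comod k H) : Comod k H := ihom (leftTwist k H) W V

/-- The isomorphism `Hom^l(W ⊗ W', V) ≅ Hom^l(W, Hom^l(W', V))`. -/
def homLCurry (W W' V : Comod k H) : homL (W ⊗ W') V ≅ homL W (homL W' V) where
  hom := toIhom₂ _ _ (TensorProduct.lcurry (RingHom.id k) W W' V ∘ₗ
      ihomVal (leftTwist k H) (W ⊗ W') V) <| by
    intro f w w'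
    refine (coact_ihomVal (leftTwist k H) f (w ⊗ₜ w' : W ⊗[k] W')).trans ?_
    refine (congrArg _ (coact_tmul w w')).trans ?_
    generalize (coact f : homL (W ⊗ W') V ⊗[k] H) = y
    generalize (coact w : W ⊗[k] H) = z
    generalize (coact w' : W' ⊗[k] H) = x
    induction y with
    | zero => simp
    | add x x' hx hx' => simp only [map_add, LinearMap.add_apply, hx, hx']
    | tmul a b =>
      induction z with
      | zero => simp
      | add x x' hx hx' => simp only [map_add, LinearMap.add_apply, hx, hx']
      | tmul c d =>
        induction x with
        | zero => simp
        | add x x' hx hx' => simp only [map_add, hx, hx']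
        | tmul e f =>
          exact congrArg
            (fun h : H => ihomVal (leftTwist k H) (W ⊗ W') V a (c ⊗ₜ[k] e : W ⊗[k] W') ⊗ₜ[k] h)
            (mul_assoc b d f).symm
  inv := toIhom (W := W ⊗ W') _ (TensorProduct.uncurry (RingHom.id k) W W' V ∘ₗ
      LinearMap.compRight k (ihomVal (leftTwist k H) W' V) ∘ₗ
        ihomVal (leftTwist k H) W (homL W' V)) <| by
    intro F x
    refine TensorProduct.induction_on x ?_ ?_ ?_
    · rw [map_zero, map_zero, map_zero, map_zero]
    · intro w w'
      change coact (ihomVal (leftTwist k H) W' V (ihomVal (leftTwist k H) W (homL W' V) F w) w') = _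
      rw [coact_ihomVal, coact_ihomVal]
      refine Eq.trans ?_ (congrArg _ (coact_tmul w w')).symm
      generalize (coact F : homL W (homL W' V) ⊗[k] H) = y
      generalize (coact w : W ⊗[k] H) = z
      generalize (coact w' : W' ⊗[k] H) = x
      induction y with
      | zero => simp
      | add x x' hx hx' => simp only [map_add, LinearMap.add_apply, hx, hx']
      | tmul a b =>
        induction z with
        | zero => simp
        | add x x' hx hx' => simp only [map_add, LinearMap.add_apply, hx, hx']
        | tmul c d =>
          induction x with
          | zero => simp
          | add x x' hx hx' => simp only [map_add, hx, hx']
          | tmul e f =>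
            exact congrArg
              (fun h : H => ihomVal (leftTwist k H) W' V
              (ihomVal (leftTwist k H) W (homL W' V) a c) e ⊗ₜ[k] h) (mul_assoc b d f)
    · intro x y hx hy
      rw [map_add, map_add, map_add, map_add, hx, hy]
  hom_inv_id := to_ihom_ext _ fun f => TensorProduct.ext' fun w w' => rfl
  inv_hom_id := hom_ext fun f => rfl

end Left

section Right

variable [HasBijectiveAntipode k H]

/-- The right internal Hom `Hom^r(W, V)`: the subspace of those `f ∈ Hom(W, V)` with
`ρ f ∈ Hom(W, V) ⊗ H`, where `ρ f (w) = f(w₀)₀ ⊗ S⁻¹(w₁) f(w₀)₁`, with the coaction `ρ`. -/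
abbrev homR (W V : Comod k H) : Comod k H := ihom (rightTwist k H) W V

/-- The isomorphism `Hom^r(W ⊗ W', V) ≅ Hom^r(W', Hom^r(W, V))`. -/
def homRCurry (W W' V : Comod k H) : homR (W ⊗ W') V ≅ homR W' (homR W V) where
  hom := toIhom₂ _ _ (LinearMap.lflip.toLinearMap ∘ₗ
      TensorProduct.lcurry (RingHom.id k) W W' V ∘ₗ
      ihomVal (rightTwist k H) (W ⊗ W') V) <| by
    intro f w' w
    refine (coact_ihomVal (rightTwist k H) f (w ⊗ₜ w' : W ⊗[k] W')).trans ?_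
    refine (congrArg _ (coact_tmul w w')).trans ?_
    generalize (coact f : homR (W ⊗ W') V ⊗[k] H) = y
    generalize (coact w : W ⊗[k] H) = z
    generalize (coact w' : W' ⊗[k] H) = x
    induction y with
    | zero => simp
    | add x x' hx hx' => simp only [map_add, LinearMap.add_apply, hx, hx']
    | tmul a b =>
      induction z with
      | zero => simp
      | add x x' hx hx' => simp only [map_add, LinearMap.add_apply, hx, hx']
      | tmul c d =>
        induction x with
        | zero => simp
        | add x x' hx hx' => simp only [map_add, LinearMap.add_apply, hx, hx']
        | tmul e f =>
          exact congrArg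
            (fun h : H => ihomVal (rightTwist k H) (W ⊗ W') V a (c ⊗ₜ[k] e : W ⊗[k] W') ⊗ₜ[k] h)
            (mul_assoc d f b)
  inv := toIhom (W := W ⊗ W') _ (TensorProduct.uncurry (RingHom.id k) W W' V ∘ₗ
      LinearMap.lflip.toLinearMap ∘ₗ
      LinearMap.compRight k (ihomVal (rightTwist k H) W V) ∘ₗ
        ihomVal (rightTwist k H) W' (homR W V)) <| by
    intro F x
    refine TensorProduct.induction_on x ?_ ?_ ?_
    · rw [map_zero, map_zero, map_zero, map_zero]
    · intro w w'
      change coact (ihomVal (rightTwist k H) W V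
        (ihomVal (rightTwist k H) W' (homR W V) F w') w) = _
      rw [coact_ihomVal, coact_ihomVal]
      refine Eq.trans ?_ (congrArg _ (coact_tmul w w')).symm
      generalize (coact F : homR W' (homR W V) ⊗[k] H) = y
      generalize (coact w : W ⊗[k] H) = z
      generalize (coact w' : W' ⊗[k] H) = x
      induction y with
      | zero => simp
      | add x x' hx hx' => simp only [map_add, LinearMap.add_apply, hx, hx']
      | tmul a b =>
        induction z with
        | zero => simp
        | add x x' hx hx' => simp only [map_add, LinearMap.add_apply, hx, hx']
        | tmul c d =>
          induction x with
          | zero => simp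
          | add x x' hx hx' => simp only [map_add, LinearMap.add_apply, hx, hx']
          | tmul e f =>
            exact congrArg
              (fun h : H => ihomVal (rightTwist k H) W V
              (ihomVal (rightTwist k H) W' (homR W V) a e) c ⊗ₜ[k] h) (mul_assoc d f b).symm
    · intro x y hx hy
      rw [map_add, map_add, map_add, map_add, hx, hy]
  hom_inv_id := to_ihom_ext _ fun f => TensorProduct.ext' fun w w' => rfl
  inv_hom_id := hom_ext fun f => rfl

/-- The isomorphism `Hom^l(W, Hom^r(V, M)) ≅ Hom^r(V, Hom^l(W, M))`. -/
def homLRFlip (W V M : Comod k H) : homL W (homR V M) ≅ homR V (homL W M) :=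
  ihomFlipIso _ _ (fun a b c => (mul_assoc c a b).symm) W V M

end Right

end Comod

/-! ## The opposite bimodule category `𝓜^{H op}` -/

namespace Comod

open MonoidalCategory

variable {k H : Type u} [Field k] [Ring H] [HopfAlgebra k H]

/-- The left action `W ▷ V = Hom^l(W, V)` of `𝓜^H` on the opposite category. -/
instance leftAction : MonoidalLeftAction (Comod k H) (Comod k H)ᵒᵖ where
  actionObj W V := op (homL W V.unop)
  actionHomLeft φ V := (ihomMap (leftTwist k H) φ (𝟙 V.unop)).op
  actionHomRight W _ _ θ := (ihomMap (leftTwist k H) (𝟙 W) θ.unop).op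
  actionHom φ θ := (ihomMap (leftTwist k H) φ θ.unop).op
  actionAssocIso W W' V := (homLCurry W W' V.unop).symm.op
  actionUnitIso V := (ihomUnit (leftTwist k H) (fun a => mul_one a) V.unop).symm.op
  actionHom_def _ _ := Quiver.Hom.unop_inj (hom_ext fun _ => rfl)
  actionHomRight_id _ _ := Quiver.Hom.unop_inj (hom_ext fun _ => rfl)
  id_actionHomLeft _ _ := Quiver.Hom.unop_inj (hom_ext fun _ => rfl)
  actionHom_comp _ _ _ _ := Quiver.Hom.unop_inj (hom_ext fun _ => rfl)
  actionAssocIso_hom_naturality _ _ _ := Quiver.Hom.unop_inj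
    (to_ihom_ext _ fun _ => TensorProduct.ext' fun _ _ => rfl)
  actionUnitIso_hom_naturality θ := Quiver.Hom.unop_inj
    (to_ihom_ext _ fun v => LinearMap.ext fun c => ((toLin θ.unop).map_smul c v).symm)
  whiskerLeft_actionHomLeft _ _ _ _ _ := Quiver.Hom.unop_inj
    (to_ihom_ext _ fun _ => TensorProduct.ext' fun _ _ => rfl)
  whiskerRight_actionHomLeft _ _ _ := Quiver.Hom.unop_inj
    (to_ihom_ext _ fun _ => TensorProduct.ext' fun _ _ => rfl)
  associator_actionHom _ _ _ _ := Quiver.Hom.unop_inj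
    (to_ihom_ext _ fun _ => TensorProduct.ext_threefold fun _ _ _ => rfl)
  leftUnitor_actionHom _ _ := Quiver.Hom.unop_inj
    (to_ihom_ext _ fun f => TensorProduct.ext' fun c w => (ihomVal _ _ _ f).map_smul c w)
  rightUnitor_actionHom _ _ := Quiver.Hom.unop_inj
    (to_ihom_ext _ fun f => TensorProduct.ext' fun w c => (ihomVal _ _ _ f).map_smul c w)

variable [HasBijectiveAntipode k H]

/-- The right action `V ◁ W = Hom^r(W, V)` of `𝓜^H` on the opposite category. -/
instance rightAction : MonoidalRightAction (Comod k H) (Comod k H)ᵒᵖ where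
  actionObj V W := op (homR W V.unop)
  actionHomRight V _ _ φ := (ihomMap (rightTwist k H) φ (𝟙 V.unop)).op
  actionHomLeft θ W := (ihomMap (rightTwist k H) (𝟙 W) θ.unop).op
  actionHom θ φ := (ihomMap (rightTwist k H) φ θ.unop).op
  actionAssocIso V W W' := (homRCurry W W' V.unop).symm.op
  actionUnitIso V := (ihomUnit (rightTwist k H) (fun a => one_mul a) V.unop).symm.op
  actionHom_def _ _ := Quiver.Hom.unop_inj (hom_ext fun _ => rfl)
  actionHomRight_id _ _ := Quiver.Hom.unop_inj (hom_ext fun _ => rfl)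
  id_actionHomLeft _ _ := Quiver.Hom.unop_inj (hom_ext fun _ => rfl)
  actionHom_comp _ _ _ _ := Quiver.Hom.unop_inj (hom_ext fun _ => rfl)
  actionAssocIso_hom_naturality _ _ _ := Quiver.Hom.unop_inj
    (to_ihom_ext _ fun _ => TensorProduct.ext' fun _ _ => rfl)
  actionUnitIso_hom_naturality θ := Quiver.Hom.unop_inj
    (to_ihom_ext _ fun v => LinearMap.ext fun c => ((toLin θ.unop).map_smul c v).symm)
  actionHomRight_whiskerRight _ _ _ := Quiver.Hom.unop_inj
    (to_ihom_ext _ fun _ => TensorProduct.ext' fun _ _ => rfl)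
  whiskerRight_actionHomLeft _ _ _ _ _ := Quiver.Hom.unop_inj
    (to_ihom_ext _ fun _ => TensorProduct.ext' fun _ _ => rfl)
  actionHom_associator _ _ _ _ := Quiver.Hom.unop_inj
    (to_ihom_ext _ fun _ => TensorProduct.ext_threefold fun _ _ _ => rfl)
  actionHom_leftUnitor _ _ := Quiver.Hom.unop_inj
    (to_ihom_ext _ fun f => TensorProduct.ext' fun c w => (ihomVal _ _ _ f).map_smul c w)
  actionHom_rightUnitor _ _ := Quiver.Hom.unop_inj
    (to_ihom_ext _ fun f => TensorProduct.ext' fun w c => (ihomVal _ _ _ f).map_smul c w)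

/-- `𝓜^{H op}` is a bimodule category over `𝓜^H`; the middle isomorphism exchanges arguments. -/
instance opBimodule : BimoduleCategory (Comod k H) (Comod k H)ᵒᵖ where
  midIso W M V := (homLRFlip W V M.unop).op
  midIso_naturality _ _ _ := Quiver.Hom.unop_inj (hom_ext fun _ => rfl)
  midIso_tensor_left _ _ _ _ := Quiver.Hom.unop_inj (to_ihom_ext _ fun _ => LinearMap.ext fun _ =>
    ihomVal_injective _ _ _ (TensorProduct.ext' fun _ _ => rfl))
  midIso_tensor_right _ _ _ _ := Quiver.Hom.unop_inj (to_ihom_ext _ fun _ =>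
    TensorProduct.ext' fun _ _ => rfl)
  midIso_unit_left _ _ := Quiver.Hom.unop_inj (hom_ext fun _ => rfl)
  midIso_unit_right _ _ := Quiver.Hom.unop_inj (hom_ext fun _ => rfl)

end Comod

/-! ## Anti-Yetter–Drinfeld modules -/

section AYD

variable (k : Type*) {H : Type*} [Field k] [Ring H] [HopfAlgebra k H]

/-- The map `H ⊗ (H ⊗ H) → M ⊗ H`, `a ⊗ (b ⊗ c) ↦ ∑ b mᵢ ⊗ c hᵢ S(a)`, for a fixed element
`y = ∑ mᵢ ⊗ hᵢ` of `M ⊗ H`. -/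
def aydMap {M : Type*} [AddCommGroup M] [Module k M] [Module H M] [IsScalarTower k H M]
    (y : M ⊗[k] H) : H ⊗[k] (H ⊗[k] H) →ₗ[k] M ⊗[k] H :=
  TensorProduct.lift
    ((TensorProduct.map₂ (Algebra.lsmul k k M).toLinearMap (LinearMap.mul k H)).flip ∘ₗ
      (LinearMap.mul' k H).lTensor M ∘ₗ (TensorProduct.assoc k M H H).toLinearMap ∘ₗ
      TensorProduct.mk k (M ⊗[k] H) H y ∘ₗ HopfAlgebra.antipode k)

theorem aydMap_tmul {M : Type*} [AddCommGroup M] [Module k M] [Module H M] [IsScalarTower k H M]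
    (m : M) (h a b c : H) : aydMap k (m ⊗ₜ h) (a ⊗ₜ (b ⊗ₜ c)) =
      (b • m) ⊗ₜ[k] (c * (h * HopfAlgebra.antipode k a)) := rfl

end AYD

/-- A left-right anti-Yetter–Drinfeld module over `H`: a left module and right comodule `M` with
`(hm)₀ ⊗ (hm)₁ = h² m₀ ⊗ h³ m₁ S(h¹)`, where `Δ²(h) = h¹ ⊗ h² ⊗ h³`. -/
structure AYDModule (k H : Type u) [Field k] [Ring H] [HopfAlgebra k H] where
  /-- The underlying vector space. -/
  carrier : Type u
  [addCommGroup : AddCommGroup carrier]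
  [module : Module k carrier]
  [hmodule : Module H carrier]
  [scalarTower : IsScalarTower k H carrier]
  [comodule : RightComodule k H carrier]
  coact_smul : ∀ (h : H) (m : carrier), (coact (h • m) : carrier ⊗[k] H) =
    aydMap k (coact m)
      ((Coalgebra.comul (R := k) (A := H)).lTensor H (Coalgebra.comul (R := k) h))

namespace AYDModule

attribute [instance] addCommGroup module hmodule scalarTower comodule

variable {k H : Type u} [Field k] [Ring H] [HopfAlgebra k H]

instance : CoeSort (AYDModule k H) (Type u) := ⟨carrier⟩

/-- The underlying comodule. -/
abbrev comod (M : AYDModule k H) : Comod k H := ⟨M⟩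

/-- A morphism is a morphism of comodules that is `H`-linear. -/
@[ext]
structure Hom (M N : AYDModule k H) where
  /-- The underlying morphism of comodules. -/
  hom : M.comod ⟶ N.comod
  map_hsmul : ∀ (h : H) (m : M),
    (Comod.toLin hom (h • m : M) : N) = h • (Comod.toLin hom m : N)

instance : Category (AYDModule k H) where
  Hom := Hom
  id M := { hom := 𝟙 M.comod, map_hsmul := fun _ _ => rfl }
  comp f g :=
    { hom := f.hom ≫ g.hom
      map_hsmul := fun h m => (congrArg (Comod.toLin g.hom) (f.map_hsmul h m)).trans
        (g.map_hsmul h _) }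
  id_comp _ := Hom.ext (Category.id_comp _)
  comp_id _ := Hom.ext (Category.comp_id _)
  assoc _ _ _ := Hom.ext (Category.assoc _ _ _)

variable (k H) in
/-- The functor forgetting the action of `H`. -/
def toComod : AYDModule k H ⥤ Comod k H where
  obj M := M.comod
  map f := Hom.hom f

/-- For `f : W → M` the map `w ↦ w₁ f(w₀)`. -/
def tauMap (M : AYDModule k H) {W : Comod k H} (f : W →ₗ[k] M) : W →ₗ[k] M :=
  TensorProduct.lift ((Algebra.lsmul k k M).toLinearMap.flip ∘ₗ f) ∘ₗ coact (k := k) (H := H)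

end AYDModule

end

/-! For a comodule `W`, a bilinear map `β : N × H → N'` gives an operator on linear maps out of `W`,
namely `G ↦ (w ↦ β(G(w₀), w₁))`. By coassociativity, composing such operators amounts to convolving
the bilinear maps (`bindCoact_bindCoact`). The twists defining `ρ^l` and `ρ^r` are of this kind, and
so is `τf(w) = w₁f(w₀)`, so operator identities reduce to identities in `H`.

From modules to the center: undo `ρ^r` after acting on the first factor of `ρ^l f`. The three
operators use `w₁`, `w₂`, `w₃` in turn and send `m ⊗ a` to `w₂m ⊗ w₃ a S(w₁)`, which is the right
side of the anti-Yetter–Drinfeld equation (`twist_bindCoact_twist`). That equation therefore says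
`ρ^r(τf) = (τ ⊗ id)(ρ^l f)`. Hence `τ` carries `Hom^l` to `Hom^r` and is colinear. Acting by
`S⁻¹(w₁)` inverts it. The tensor condition is `(w₁w'₁)m = w₁(w'₁m)`, and the unit condition is `1m =
m`.

From the center to modules: a finite-dimensional `W` has `Hom^l(W, X) = Hom_k(W, X)`. Every `h` in
`H` lies in a finite-dimensional subcomodule `N` of `H`, and `hm` is defined as `τ_N(ε ⊗ m)(h)`,
where `ε ⊗ m` is the map `n ↦ ε(n)m`. Naturality makes this independent of `N` and linear in `h`
(`coeffOp_eq_hmul`). The multiplication `N ⊗ N' → H` and the unit `k → H` are colinear, so the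
tensor and unit conditions give the module axioms.

The action determines `τ`. A functional `φ` on `W` equals `ε` composed with the colinear map `w ↦
φ(w₀)w₁` into `H`, which settles finite-dimensional `W` (`finOp_eq_bindCoact`). Each element of a
general `W` lies in a finite-dimensional subcomodule, which settles the rest (`ihomVal_sigma`).
Colinearity of `τ`, tested on `ε ⊗ m`, returns the anti-Yetter–Drinfeld equation. The same test
shows that morphisms of the center are `H`-linear. -/

open RightComodule

noncomputable section

/-! ### Convolution operators on linear maps out of a comodule -/

section BindCoact

variable {k H : Type*} [Field k] [Ring H] [Bialgebra k H]
variable {W : Type*} [AddCommGroup W] [Module k W] [RightComodule k H W]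
variable {N N' N'' : Type*} [AddCommGroup N] [Module k N] [AddCommGroup N'] [Module k N']
  [AddCommGroup N''] [Module k N'']

/-- For a bilinear map `β`, the operator `G ↦ (w ↦ β (G w₀) w₁)`. -/
def bindCoact (β : N →ₗ[k] H →ₗ[k] N') : (W →ₗ[k] N) →ₗ[k] (W →ₗ[k] N') where
  toFun G := TensorProduct.lift (β ∘ₗ G) ∘ₗ coact
  map_add' G G' := by
    ext w
    simp only [LinearMap.comp_apply, LinearMap.add_apply]
    generalize (coact w : W ⊗[k] H) = y
    induction y with
    | zero => simp
    | add x y hx hy => simp only [map_add, hx, hy]; abel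
    | tmul w h => simp
  map_smul' c G := by
    ext w
    simp only [LinearMap.comp_apply, LinearMap.smul_apply, RingHom.id_apply]
    generalize (coact w : W ⊗[k] H) = y
    induction y with
    | zero => simp
    | add x y hx hy => simp only [map_add, hx, hy, smul_add]
    | tmul w h => simp

theorem bindCoact_apply (β : N →ₗ[k] H →ₗ[k] N') (G : W →ₗ[k] N) (w : W) :
    bindCoact β G w = TensorProduct.lift (β ∘ₗ G) (coact w) := rfl

/-- Coassociativity turns the two successive coactions on `w` into one coaction followed by `Δ` on
`w₁`. The inner operator receives the first leg of `Δ` and the outer operator the second. -/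
theorem bindCoact_bindCoact (β : N →ₗ[k] H →ₗ[k] N') (γ : N' →ₗ[k] H →ₗ[k] N'')
    (δ : N →ₗ[k] H →ₗ[k] N'')
    (h : ∀ n u, TensorProduct.lift (γ ∘ₗ β n) (Coalgebra.comul (R := k) u) = δ n u)
    (G : W →ₗ[k] N) : bindCoact γ (bindCoact β G) = bindCoact δ G := by
  ext w
  have h1 : ∀ y : W ⊗[k] H, TensorProduct.lift (γ ∘ₗ bindCoact β G) y =
      TensorProduct.lift (γ ∘ₗ TensorProduct.lift (β ∘ₗ G)) (coact.rTensor H y) := by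
    intro y
    induction y with
    | zero => simp
    | add x y hx hy => simp only [map_add, hx, hy]
    | tmul w u => simp [bindCoact_apply]
  rw [bindCoact_apply, bindCoact_apply, h1, coassoc_apply']
  generalize (coact w : W ⊗[k] H) = y
  induction y with
  | zero => simp
  | add x y hx hy => simp only [map_add, hx, hy]
  | tmul w u =>
    rw [LinearMap.lTensor_tmul, TensorProduct.lift.tmul, LinearMap.comp_apply, ← h]
    generalize (Coalgebra.comul (R := k) u : H ⊗[k] H) = z
    induction z with
    | zero => simp
    | add x y hx hy => simp only [map_add, hx, hy, TensorProduct.tmul_add]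
    | tmul b c => simp

theorem bindCoact_counit (G : W →ₗ[k] N) :
    bindCoact ((LinearMap.lsmul k N).flip.compl₂ (Coalgebra.counit (R := k) (A := H))) G = G := by
  ext w
  have h1 : ∀ y : W ⊗[k] H, TensorProduct.lift
      ((LinearMap.lsmul k N).flip.compl₂ (Coalgebra.counit (R := k) (A := H)) ∘ₗ G) y =
      TensorProduct.rid k N (G.rTensor k ((Coalgebra.counit (R := k) (A := H)).lTensor W y)) := by
    intro y
    induction y with
    | zero => simp
    | add x y hx hy => simp only [map_add, hx, hy]
    | tmul w u => simp
  rw [bindCoact_apply, h1, counit_apply]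
  simp

/-- Two bilinear maps that are inverse to each other under convolution give inverse operators. -/
theorem bindCoact_inverse (β : N →ₗ[k] H →ₗ[k] N') (γ : N' →ₗ[k] H →ₗ[k] N)
    (h : ∀ n u, TensorProduct.lift (γ ∘ₗ β n) (Coalgebra.comul (R := k) u) =
      Coalgebra.counit (R := k) u • n)
    (G : W →ₗ[k] N) : bindCoact γ (bindCoact β G) = G :=
  (bindCoact_bindCoact β γ _ h G).trans (bindCoact_counit G)

/-- Places the twists behind `ρ^l` and `ρ^r` in the same family as `τ`, so that the composition law
applies to mixtures of them. -/
theorem twist_eq_bindCoact {V : Type*} [AddCommGroup V] [Module k V] (β : H →ₗ[k] H →ₗ[k] H)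
    (G : W →ₗ[k] V ⊗[k] H) : twist β G =
      bindCoact (TensorProduct.curry ((TensorProduct.lift β).lTensor V ∘ₗ
        (TensorProduct.assoc k V H H).toLinearMap)) G := by
  ext w
  rw [twist_apply, bindCoact_apply]
  generalize (coact w : W ⊗[k] H) = y
  induction y with
  | zero => simp
  | add x y hx hy => simp only [map_add, hx, hy]
  | tmul w u => simp

theorem CoactionTwist.rho_eq_twist {V : Type*} [AddCommGroup V] [Module k V]
    [RightComodule k H V] (t : CoactionTwist k H) (f : W →ₗ[k] V) :
    t.rho f = twist t.op (coact (k := k) (H := H) ∘ₗ f) := rfl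

end BindCoact

/-! ### Operators extended to `M ⊗ H` -/

section ExtendAct

variable {k H : Type*} [Field k] [Ring H] [Bialgebra k H]
variable {W : Type*} [AddCommGroup W] [Module k W] [RightComodule k H W]
variable {M : Type*} [AddCommGroup M] [Module k M]

/-- The extension `(m ⊗ a, h) ↦ β m h ⊗ a` of `β` to `M ⊗ H`. -/
def extendAct (β : M →ₗ[k] H →ₗ[k] M) : M ⊗[k] H →ₗ[k] H →ₗ[k] M ⊗[k] H :=
  TensorProduct.curry ((TensorProduct.lift β).rTensor H ∘ₗ
    (TensorProduct.rightComm k M H H).toLinearMap)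

@[simp]
theorem extendAct_tmul (β : M →ₗ[k] H →ₗ[k] M) (m : M) (a h : H) :
    extendAct β (m ⊗ₜ a) h = β m h ⊗ₜ a := rfl

theorem lift_zero_apply {A B C : Type*} [AddCommGroup A] [Module k A] [AddCommGroup B]
    [Module k B] [AddCommGroup C] [Module k C] (z : A ⊗[k] B) :
    TensorProduct.lift (0 : A →ₗ[k] B →ₗ[k] C) z = 0 := by
  induction z with
  | zero => rw [map_zero]
  | add x y hx hy => rw [map_add, hx, hy, add_zero]
  | tmul a b => rfl

theorem lift_comp_add {A B C D : Type*} [AddCommGroup A] [Module k A] [AddCommGroup B]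
    [Module k B] [AddCommGroup C] [Module k C] [AddCommGroup D] [Module k D]
    (γ : C →ₗ[k] B →ₗ[k] D) (b b' : A →ₗ[k] C) (z : A ⊗[k] B) :
    TensorProduct.lift (γ ∘ₗ (b + b')) z =
      TensorProduct.lift (γ ∘ₗ b) z + TensorProduct.lift (γ ∘ₗ b') z := by
  induction z with
  | zero => simp only [map_zero, add_zero]
  | add x y hx hy =>
    rw [LinearMap.map_add, LinearMap.map_add, LinearMap.map_add, hx, hy]
    abel
  | tmul a b => simp

/-- The extension leaves the factor `H` of `M ⊗ H` untouched, so convolution inverses survive it. -/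
theorem extendAct_inverse (β γ : M →ₗ[k] H →ₗ[k] M)
    (h : ∀ n u, TensorProduct.lift (γ ∘ₗ β n) (Coalgebra.comul (R := k) u) =
      Coalgebra.counit (R := k) u • n) (n : M ⊗[k] H) (u : H) :
    TensorProduct.lift (extendAct γ ∘ₗ extendAct β n) (Coalgebra.comul (R := k) u) =
      Coalgebra.counit (R := k) u • n := by
  induction n with
  | zero =>
    rw [map_zero, LinearMap.comp_zero, smul_zero, lift_zero_apply]
  | add x y hx hy => rw [map_add, lift_comp_add, hx, hy, smul_add]
  | tmul m a =>
    rw [TensorProduct.smul_tmul', ← h]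
    generalize (Coalgebra.comul (R := k) u : H ⊗[k] H) = z
    induction z with
    | zero => simp
    | add x y hx hy => simp only [map_add, hx, hy, TensorProduct.add_tmul]
    | tmul b c => simp

/-- The extended operator acts only on the `Hom` factor, so it preserves the subspace `Hom(W, M) ⊗
H` of `Hom(W, M ⊗ H)`. Membership in `Hom^l` and `Hom^r` is compared through this. -/
theorem bindCoact_homTensor (β : M →ₗ[k] H →ₗ[k] M) (x : (W →ₗ[k] M) ⊗[k] H) :
    bindCoact (extendAct β) (homTensor k H W M x) =
      homTensor k H W M ((bindCoact β).rTensor H x) := by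
  induction x with
  | zero => simp
  | add x y hx hy => simp only [map_add, hx, hy]
  | tmul f h =>
    ext w
    rw [bindCoact_apply, LinearMap.rTensor_tmul,
      TensorProduct.rTensorHomToHomRTensor_apply, bindCoact_apply]
    generalize (coact w : W ⊗[k] H) = z
    induction z with
    | zero => simp
    | add x y hx hy => simp only [map_add, hx, hy, TensorProduct.add_tmul]
    | tmul b c => simp

end ExtendAct

/-! ### The anti-Yetter–Drinfeld expression as a composite of operators -/

section Action

variable (k H : Type*) [Field k] [Ring H] [HopfAlgebra k H] (M : Type*) [AddCommGroup M]
  [Module k M] [Module H M] [IsScalarTower k H M]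

/-- The action of `H` on `M` as a bilinear map `(m, h) ↦ h m`. -/
abbrev hopfAct : M →ₗ[k] H →ₗ[k] M := (Algebra.lsmul k k M).toLinearMap.flip

variable {k H M}

/-- Splits off the factor `S(a)` as a left twist. What remains is the diagonal action of the other
two legs. -/
theorem aydMap_tmul_eq (y : M ⊗[k] H) (a : H) (z : H ⊗[k] H) : aydMap k y (a ⊗ₜ z) =
    TensorProduct.map₂ (Algebra.lsmul k k M).toLinearMap (LinearMap.mul k H) z
      ((TensorProduct.lift (leftTwist k H).op).lTensor M
        (TensorProduct.assoc k M H H (y ⊗ₜ a))) := by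
  have key : (LinearMap.mul' k H).lTensor M
      (TensorProduct.assoc k M H H (y ⊗ₜ HopfAlgebra.antipode k a)) =
      (TensorProduct.lift (leftTwist k H).op).lTensor M
        (TensorProduct.assoc k M H H (y ⊗ₜ a)) := by
    induction y with
    | zero => simp
    | add x y hx hy => simp only [TensorProduct.add_tmul, map_add, hx, hy]
    | tmul m b => rfl
  exact congrArg (TensorProduct.map₂ (Algebra.lsmul k k M).toLinearMap (LinearMap.mul k H) z) key

variable (k H M) in
/-- The map `(y, h) ↦ b yᵢ ⊗ c hᵢ S(a)` for `Δ²(h) = a ⊗ b ⊗ c`, as a bilinear map. -/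
def aydBilin : M ⊗[k] H →ₗ[k] H →ₗ[k] M ⊗[k] H :=
  LinearMap.lcomp k _ Coalgebra.comul ∘ₗ TensorProduct.uncurry (RingHom.id k) H H (M ⊗[k] H) ∘ₗ
    LinearMap.compRight k
      ((TensorProduct.map₂ (Algebra.lsmul k k M).toLinearMap (LinearMap.mul k H)).flip.compl₂
        (Coalgebra.comul (R := k) (A := H))) ∘ₗ
    TensorProduct.curry ((TensorProduct.lift (leftTwist k H).op).lTensor M ∘ₗ
        (TensorProduct.assoc k M H H).toLinearMap)

theorem aydBilin_apply (y : M ⊗[k] H) (h : H) : aydBilin k H M y h = aydMap k y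
    ((Coalgebra.comul (R := k) (A := H)).lTensor H (Coalgebra.comul (R := k) h)) := by
  simp only [aydBilin, LinearMap.comp_apply, LinearMap.lcomp_apply]
  generalize (Coalgebra.comul (R := k) h : H ⊗[k] H) = z
  induction z with
  | zero => rw [map_zero, map_zero, map_zero]
  | add x y hx hy => rw [map_add, map_add, map_add, hx, hy]
  | tmul b c =>
    rw [LinearMap.lTensor_tmul, aydMap_tmul_eq]
    rfl

variable [HasBijectiveAntipode k H]

/-- Read from the inside, the three operators multiply by `S(w₁)` on the right, act on `M` by `w₂`,
and multiply by `w₃` on the left. The total effect on `m ⊗ a` is `w₂m ⊗ w₃ a S(w₁)`. -/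
theorem twist_bindCoact_twist {W : Type*} [AddCommGroup W] [Module k W] [RightComodule k H W]
    (G : W →ₗ[k] M ⊗[k] H) : twist (rightTwist k H).inv
      (bindCoact (extendAct (hopfAct k H M)) (twist (leftTwist k H).op G)) =
      bindCoact (aydBilin k H M) G := by
  -- The two outer operators combine into the diagonal action `m ⊗ a ↦ u₁m ⊗ u₂a`. Convolving this
  -- with the left twist is `aydBilin` by definition.
  have hB : ∀ (y : M ⊗[k] H) (u : H), TensorProduct.lift
      (TensorProduct.curry ((TensorProduct.lift (rightTwist k H).inv).lTensor M ∘ₗ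
        (TensorProduct.assoc k M H H).toLinearMap) ∘ₗ extendAct (hopfAct k H M) y)
        (Coalgebra.comul (R := k) u) =
      (TensorProduct.map₂ (Algebra.lsmul k k M).toLinearMap (LinearMap.mul k H)).flip.compl₂
        Coalgebra.comul y u := by
    intro y u
    rw [LinearMap.compl₂_apply]
    generalize (Coalgebra.comul (R := k) u : H ⊗[k] H) = z
    induction y with
    | zero => rw [map_zero, map_zero, LinearMap.comp_zero, lift_zero_apply, LinearMap.zero_apply]
    | add x y hx hy => rw [map_add, lift_comp_add, hx, hy, LinearMap.map_add, LinearMap.add_apply]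
    | tmul m a =>
      induction z with
      | zero => rw [map_zero, map_zero]
      | add x y hx hy => rw [map_add, map_add, hx, hy]
      | tmul b c => rfl
  rw [twist_eq_bindCoact, bindCoact_bindCoact _ _ _ hB, twist_eq_bindCoact,
    bindCoact_bindCoact _ _ (aydBilin k H M) (fun _ _ => rfl)]

end Action

/-! ### The isomorphism `τ` of an anti-Yetter–Drinfeld module -/

namespace AYDModule

variable {k H : Type u} [Field k] [Ring H] [HopfAlgebra k H] (M : AYDModule k H)

/-- The action of `H` on `M` as a bilinear map `(m, h) ↦ h m`. -/
abbrev act : M →ₗ[k] H →ₗ[k] M := hopfAct k H M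

theorem tauMap_eq_bindCoact {W : Comod k H} (f : W →ₗ[k] M) :
    M.tauMap f = bindCoact M.act f := rfl

variable [HasBijectiveAntipode k H]

/-- The bilinear map `(m, h) ↦ S⁻¹(h) m`. -/
def actInv : M →ₗ[k] H →ₗ[k] M := M.act.compl₂ (antipodeInv k H)

/-- This is `S⁻¹(h²)h¹ = ε(h)`. The order of the legs is the reason that `S⁻¹`, rather than `S`,
inverts `τ`. -/
theorem actInv_act (m : M) (h : H) :
    TensorProduct.lift (M.actInv ∘ₗ M.act m) (Coalgebra.comul (R := k) h) =
      Coalgebra.counit (R := k) h • m := by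
  rw [← one_smul H m, ← smul_assoc, ← antipodeInv_mul]
  generalize (Coalgebra.comul (R := k) h : H ⊗[k] H) = z
  induction z with
  | zero => simp
  | add x y hx hy => simp only [map_add, hx, hy, add_smul]
  | tmul b c => simp [actInv, mul_smul]

/-- This is `h²S⁻¹(h¹) = ε(h)`. -/
theorem act_actInv (m : M) (h : H) :
    TensorProduct.lift (M.act ∘ₗ M.actInv m) (Coalgebra.comul (R := k) h) =
      Coalgebra.counit (R := k) h • m := by
  rw [← one_smul H m, ← smul_assoc, ← mul_antipodeInv]
  generalize (Coalgebra.comul (R := k) h : H ⊗[k] H) = z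
  induction z with
  | zero => simp
  | add x y hx hy => simp only [map_add, hx, hy, add_smul]
  | tmul b c => simp [actInv, mul_smul]

/-- By `twist_bindCoact_twist` this is the anti-Yetter–Drinfeld equation for `w₁` and `f(w₀)`, and
it holds for every linear `f`. -/
theorem coact_comp_tauMap {W : Comod k H} (f : W →ₗ[k] M) :
    coact (k := k) (H := H) ∘ₗ M.tauMap f = twist (rightTwist k H).inv
      (bindCoact (extendAct M.act)
        (twist (leftTwist k H).op (coact (k := k) (H := H) ∘ₗ f))) := by
  rw [twist_bindCoact_twist]
  ext w
  rw [LinearMap.comp_apply, tauMap_eq_bindCoact, bindCoact_apply, bindCoact_apply]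
  generalize (coact w : W ⊗[k] H) = z
  induction z with
  | zero => simp only [map_zero]
  | add x y hx hy => simp only [map_add, hx, hy]
  | tmul b c =>
    rw [TensorProduct.lift.tmul, TensorProduct.lift.tmul]
    exact (M.coact_smul c (f b)).trans (aydBilin_apply _ _).symm

/-- The twist defining `ρ^r` cancels the outermost operator of `coact_comp_tauMap`. The result is
the colinearity of `τ`, stated inside `Hom(W, M ⊗ H)` before any finiteness condition is imposed. -/
theorem rho_tauMap {W : Comod k H} (f : W →ₗ[k] M) : (rightTwist k H).rho (M.tauMap f) =
    bindCoact (extendAct M.act) ((leftTwist k H).rho f) := by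
  rw [CoactionTwist.rho_eq_twist, CoactionTwist.rho_eq_twist, coact_comp_tauMap,
    CoactionTwist.twist_op_inv]

/-- `ρ^r(τf)` and `ρ^l f` differ by an invertible operator. Both it and its inverse, built from
`S⁻¹`, preserve `Hom(W, M) ⊗ H` by `bindCoact_homTensor`. -/
theorem tauMap_mem_iff {W : Comod k H} (f : W →ₗ[k] M) :
    M.tauMap f ∈ (rightTwist k H).homSub W M ↔ f ∈ (leftTwist k H).homSub W M := by
  simp only [CoactionTwist.homSub, Submodule.mem_comap, LinearMap.mem_range, rho_tauMap]
  constructor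
  · rintro ⟨x, hx⟩
    refine ⟨(bindCoact M.actInv).rTensor H x, ?_⟩
    rw [← bindCoact_homTensor, hx]
    exact bindCoact_inverse _ _ (extendAct_inverse _ _ M.actInv_act) _
  · rintro ⟨x, hx⟩
    exact ⟨(bindCoact M.act).rTensor H x, by rw [← bindCoact_homTensor, hx]⟩

theorem bindCoact_actInv_mem {W : Comod k H} (g : (rightTwist k H).homSub W M) :
    bindCoact M.actInv g.1 ∈ (leftTwist k H).homSub W M := by
  rw [← tauMap_mem_iff, tauMap_eq_bindCoact, bindCoact_inverse _ _ M.act_actInv]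
  exact g.2

/-- The linear bijection `Hom^l(W, M) ≃ Hom^r(W, M)`, `f ↦ (w ↦ w₁ f(w₀))`. -/
def tauSub (W : Comod k H) :
    (leftTwist k H).homSub W M ≃ₗ[k] (rightTwist k H).homSub W M where
  toFun f := ⟨M.tauMap f.1, (M.tauMap_mem_iff f.1).2 f.2⟩
  map_add' f g := Subtype.ext ((bindCoact M.act).map_add f.1 g.1)
  map_smul' c f := Subtype.ext ((bindCoact M.act).map_smul c f.1)
  invFun g := ⟨bindCoact M.actInv g.1, M.bindCoact_actInv_mem g⟩
  left_inv f := Subtype.ext (bindCoact_inverse _ _ M.actInv_act f.1)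
  right_inv g := Subtype.ext (bindCoact_inverse _ _ M.act_actInv g.1)

theorem tauSub_val {W : Comod k H} (f : (leftTwist k H).homSub W M) :
    (M.tauSub W f).1 = M.tauMap f.1 := rfl

theorem subtype_comp_tauSub (W : Comod k H) :
    ((rightTwist k H).homSub W M).subtype ∘ₗ (M.tauSub W).toLinearMap =
      bindCoact M.act ∘ₗ ((leftTwist k H).homSub W M).subtype :=
  LinearMap.ext fun f => M.tauSub_val f

/-- The coactions can be compared after embedding `Hom^r(W, M) ⊗ H` into `Hom(W, M ⊗ H)`, where the
claim is `rho_tauMap`. -/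
theorem homCoact_tauSub {W : Comod k H} (f : (leftTwist k H).homSub W M) :
    (rightTwist k H).homCoact W M (M.tauSub W f) =
      (M.tauSub W).toLinearMap.rTensor H ((leftTwist k H).homCoact W M f) := by
  apply (rightTwist k H).subtype_rTensor_injective
  apply homTensor_injective
  rw [← LinearMap.rTensor_comp_apply, subtype_comp_tauSub, LinearMap.rTensor_comp_apply,
    ← bindCoact_homTensor, CoactionTwist.homTensor_homCoact, CoactionTwist.homTensor_homCoact,
    tauSub_val, rho_tauMap]

/-- The isomorphism of comodules `Hom^l(W, M) ≅ Hom^r(W, M)`, `f ↦ (w ↦ w₁ f(w₀))`. -/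
def tauIso (W : Comod k H) : Comod.homL W M.comod ≅ Comod.homR W M.comod :=
  Comod.isoMk (V := Comod.homL W M.comod) (W := Comod.homR W M.comod) (M.tauSub W)
    M.homCoact_tauSub

end AYDModule

/-! ### Central structures expressed through the inverses of `τ` -/

section CentralInv

open MonoidalCategory MonoidalLeftAction MonoidalRightAction

variable {C : Type u₁} [Category.{v₁} C] [MonoidalCategory C]
  {D : Type u₂} [Category.{v₂} D] [MonoidalLeftAction C D] [MonoidalRightAction C D]
  [BimoduleCategory C D] {X : D}

namespace CentralStructure

/-- The isomorphism `c ▷ d ≅ c ▷ d'` induced by `d ≅ d'`. -/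
def leftIso (c : C) {d d' : D} (e : d ≅ d') : (c ⊙ₗ d : D) ≅ c ⊙ₗ d' where
  hom := c ⊴ₗ e.hom
  inv := c ⊴ₗ e.inv
  hom_inv_id := by rw [← MonoidalLeftAction.actionHomRight_comp]; simp
  inv_hom_id := by rw [← MonoidalLeftAction.actionHomRight_comp]; simp

/-- The isomorphism `d ◁ c ≅ d' ◁ c` induced by `d ≅ d'`. -/
def rightIso (c : C) {d d' : D} (e : d ≅ d') : (d ⊙ᵣ c : D) ≅ d' ⊙ᵣ c where
  hom := e.hom ⊵ᵣ c
  inv := e.inv ⊵ᵣ c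
  hom_inv_id := by rw [← MonoidalRightAction.comp_actionHomLeft]; simp
  inv_hom_id := by rw [← MonoidalRightAction.comp_actionHomLeft]; simp

/-- The two sides of the compatibility with tensor products, in terms of isomorphisms. -/
theorem tensor_iff (τ : ∀ c : C, (c ⊙ₗ X : D) ≅ X ⊙ᵣ c) (c c' : C) :
    (τ (c ⊗ c')).hom ≫ (αᵣ X c c').hom =
      (αₗ c c' X).hom ≫ c ⊴ₗ (τ c').hom ≫ (BimoduleCategory.midIso c X c').inv ≫
        (τ c).hom ⊵ᵣ c' ↔
    (αᵣ X c c').inv ≫ (τ (c ⊗ c')).inv =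
      (τ c).inv ⊵ᵣ c' ≫ (BimoduleCategory.midIso c X c').hom ≫ c ⊴ₗ (τ c').inv ≫
        (αₗ c c' X).inv := by
  -- Each side is the forward map of a composite isomorphism, and two isomorphisms agree exactly
  -- when their inverses do.
  have h : (τ (c ⊗ c') ≪≫ αᵣ X c c').hom = (αₗ c c' X ≪≫ leftIso c (τ c') ≪≫
      (BimoduleCategory.midIso c X c').symm ≪≫ rightIso c' (τ c)).hom ↔
      (τ (c ⊗ c') ≪≫ αᵣ X c c').inv = (αₗ c c' X ≪≫ leftIso c (τ c') ≪≫
      (BimoduleCategory.midIso c X c').symm ≪≫ rightIso c' (τ c)).inv :=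
    ⟨fun h => congrArg Iso.inv (Iso.ext h), fun h => congrArg Iso.hom (Iso.ext_inv h)⟩
  simpa [leftIso, rightIso] using h

/-- A central structure from compatibilities of the inverses. -/
def ofInv (τ : ∀ c : C, (c ⊙ₗ X : D) ≅ X ⊙ᵣ c)
    (naturality : ∀ {c c' : C} (f : c ⟶ c'), (τ c).inv ≫ f ⊵ₗ X = X ⊴ᵣ f ≫ (τ c').inv)
    (tensor : ∀ c c' : C, (αᵣ X c c').inv ≫ (τ (c ⊗ c')).inv =
      (τ c).inv ⊵ᵣ c' ≫ (BimoduleCategory.midIso c X c').hom ≫ c ⊴ₗ (τ c').inv ≫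
        (αₗ c c' X).inv)
    (unit : (τ (𝟙_ C)).inv ≫ (λₗ X).hom = (ρᵣ X).hom) : CentralStructure C D X where
  τ := τ
  naturality f := by
    rw [← Iso.inv_comp_eq, ← Category.assoc, naturality, Category.assoc, Iso.inv_hom_id,
      Category.comp_id]
  tensor c c' := (tensor_iff τ c c').2 (tensor c c')
  unit := by rw [← unit, Iso.hom_inv_id_assoc]

variable (t : CentralStructure C D X)

theorem inv_naturality {c c' : C} (f : c ⟶ c') :
    (t.τ c).inv ≫ f ⊵ₗ X = X ⊴ᵣ f ≫ (t.τ c').inv := by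
  rw [Iso.inv_comp_eq, ← Category.assoc, ← t.naturality, Category.assoc, Iso.hom_inv_id,
    Category.comp_id]

theorem inv_unit : (t.τ (𝟙_ C)).inv ≫ (λₗ X).hom = (ρᵣ X).hom := by
  rw [← t.unit, Iso.inv_hom_id_assoc]

end CentralStructure

theorem BimoduleCenter.Hom.inv_comm {X Y : BimoduleCenter C D} (f : X.Hom Y) (c : C) :
    (X.central.τ c).inv ≫ c ⊴ₗ f.f = f.f ⊵ᵣ c ≫ (Y.central.τ c).inv := by
  rw [Iso.inv_comp_eq, ← Category.assoc, ← f.comm, Category.assoc, Iso.hom_inv_id,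
    Category.comp_id]

/-- A morphism in the center from compatibility with the inverses. -/
def BimoduleCenter.homOfInv {X Y : BimoduleCenter C D} (f : X.obj ⟶ Y.obj)
    (h : ∀ c, (X.central.τ c).inv ≫ c ⊴ₗ f = f ⊵ᵣ c ≫ (Y.central.τ c).inv) : X ⟶ Y where
  f := f
  comm c := by
    rw [← Iso.inv_comp_eq, ← Category.assoc, h, Category.assoc, Iso.inv_hom_id,
      Category.comp_id]

end CentralInv

namespace Comod

variable {k H : Type u} [Field k] [Ring H] [HopfAlgebra k H]

theorem bindCoact_comp {N N' : Type*} [AddCommGroup N] [Module k N] [AddCommGroup N']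
    [Module k N'] (β : N →ₗ[k] H →ₗ[k] N') {W W' : Comod k H} (φ : W' ⟶ W) (G : W →ₗ[k] N)
    (w : W') : bindCoact β (G ∘ₗ toLin φ) w = bindCoact β G (toLin φ w) := by
  rw [bindCoact_apply, bindCoact_apply, coact_toLin]
  generalize (coact w : W' ⊗[k] H) = z
  induction z with
  | zero => simp only [map_zero]
  | add x y hx hy => simp only [map_add, hx, hy]
  | tmul b c => rfl

end Comod

/-! ### The functor from anti-Yetter–Drinfeld modules to the center -/

namespace AYDModule

open MonoidalCategory

variable {k H : Type u} [Field k] [Ring H] [HopfAlgebra k H] (M : AYDModule k H)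

theorem tauMap_apply {W : Comod k H} (f : W →ₗ[k] M) (w : W) :
    M.tauMap f w = TensorProduct.lift (M.act ∘ₗ f) (coact w) := rfl

theorem tauMap_comp {W W' : Comod k H} (φ : W' ⟶ W) (f : W →ₗ[k] M) (w : W') :
    M.tauMap f (Comod.toLin φ w) = M.tauMap (f ∘ₗ Comod.toLin φ) w :=
  (Comod.bindCoact_comp M.act φ f w).symm

/-- The coaction on `w ⊗ w'` produces the product `w₁w'₁`, and `(w₁w'₁)m = w₁(w'₁m)`. This is the
tensor condition of the center. -/
theorem tauMap_tmul {W W' : Comod k H} (f : W ⊗[k] W' →ₗ[k] M) (w : W) (w' : W') :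
    M.tauMap (W := W ⊗ W') f (w ⊗ₜ w') =
      M.tauMap ((bindCoact M.act ∘ₗ TensorProduct.curry f).flip w') w := by
  have h1 := coact_tmul (k := k) (H := H) w w'
  rw [tauMap_apply, tauMap_apply]
  refine (congrArg _ h1).trans ?_
  generalize (coact w : W ⊗[k] H) = z
  induction z with
  | zero => simp only [map_zero, LinearMap.zero_apply]
  | add x y hx hy => simp only [map_add, LinearMap.add_apply, hx, hy]
  | tmul b c =>
    rw [TensorProduct.lift.tmul]
    change _ = c • (TensorProduct.lift (M.act ∘ₗ TensorProduct.curry f b) (coact w'))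
    generalize (coact w' : W' ⊗[k] H) = x
    induction x with
    | zero => simp only [map_zero, smul_zero]
    | add x y hx hy => simp only [map_add, smul_add, hx, hy]
    | tmul d e => exact mul_smul c e _

theorem hom_tauMap {M N : AYDModule k H} (θ : M.Hom N) {W : Comod k H} (f : W →ₗ[k] M) (w : W) :
    Comod.toLin θ.hom (M.tauMap f w) = N.tauMap (Comod.toLin θ.hom ∘ₗ f) w := by
  rw [tauMap_apply, tauMap_apply]
  generalize (coact w : W ⊗[k] H) = z
  induction z with
  | zero => simp only [map_zero]
  | add x y hx hy => simp only [map_add, hx, hy]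
  | tmul b c => exact θ.map_hsmul c (f b)

variable [HasBijectiveAntipode k H]

/-- The central structure on the comodule `M` with `τ f (w) = w₁ f(w₀)`. -/
def central : CentralStructure (Comod k H) (Comod k H)ᵒᵖ (op M.comod) :=
  CentralStructure.ofInv (fun W => (M.tauIso W).symm.op)
    (fun φ => Quiver.Hom.unop_inj (Comod.to_ihom_ext _ fun f =>
      LinearMap.ext fun w => (M.tauMap_comp φ (Comod.ihomVal (leftTwist k H) _ _ f) w).symm))
    (fun W W' => Quiver.Hom.unop_inj (Comod.to_ihom_ext _ fun f => LinearMap.ext fun w' =>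
      Comod.ihomVal_injective _ _ _ (LinearMap.ext fun w =>
        M.tauMap_tmul (Comod.ihomVal (leftTwist k H) (W ⊗ W') M.comod f) w w')))
    -- The coaction on `k` is `c ↦ c ⊗ 1`, so `τ_k` acts by `1 ∈ H`.
    (Quiver.Hom.unop_inj (Comod.to_ihom_ext _ fun m => LinearMap.ext_ring
      (one_smul H ((1 : k) • (m : M)))))

theorem central_inv (W : Comod k H) (f : Comod.homL W M.comod) :
    Comod.ihomVal (rightTwist k H) W M.comod (Comod.toLin (M.central.τ W).inv.unop f) =
      M.tauMap (Comod.ihomVal (leftTwist k H) W M.comod f) := rfl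

variable (k H) in
/-- The functor from anti-Yetter–Drinfeld modules to the (opposite of the) center. -/
def toCenter : AYDModule k H ⥤ (BimoduleCenter (Comod k H) (Comod k H)ᵒᵖ)ᵒᵖ where
  obj M := op ⟨op M.comod, M.central⟩
  map {M N} θ := Quiver.Hom.op (BimoduleCenter.homOfInv (X := ⟨op N.comod, N.central⟩)
    (Y := ⟨op M.comod, M.central⟩) (Hom.hom θ).op fun W =>
      Quiver.Hom.unop_inj (Comod.to_ihom_ext _ fun f => LinearMap.ext fun w =>
        (hom_tauMap θ (Comod.ihomVal (leftTwist k H) W M.comod f) w).symm))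

theorem toCenter_comp_forget : toCenter k H ⋙
    (BimoduleCenter.forget (Comod k H) (Comod k H)ᵒᵖ).leftOp = toComod k H := rfl

instance : (toCenter k H).Faithful where
  map_injective h := Hom.ext (Quiver.Hom.op_inj
    (congrArg BimoduleCenter.Hom.f (Quiver.Hom.op_inj h)))

end AYDModule

/-! ### Local finiteness of comodules -/

theorem exists_finite_contract {k H V : Type*} [Field k] [AddCommGroup H] [Module k H]
    [AddCommGroup V] [Module k V] (x : V ⊗[k] H) : ∃ F : Submodule k V, FiniteDimensional k F ∧
    ∀ ψ : H →ₗ[k] k, TensorProduct.rid k V (ψ.lTensor V x) ∈ F := by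
  induction x with
  | zero => exact ⟨⊥, inferInstance, fun ψ => by simp⟩
  | add x y hx hy =>
    obtain ⟨F, hF, h⟩ := hx
    obtain ⟨F', hF', h'⟩ := hy
    exact ⟨F ⊔ F', inferInstance, fun ψ => by
      rw [map_add, map_add]
      exact Submodule.add_mem_sup (h ψ) (h' ψ)⟩
  | tmul v h =>
    exact ⟨Submodule.span k {v}, inferInstance, fun ψ =>
      Submodule.smul_mem _ _ (Submodule.mem_span_singleton_self v)⟩

section Subcomodule

variable {k H V : Type*} [Field k] [AddCommGroup H] [Module k H] [Coalgebra k H]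
    [AddCommGroup V] [Module k V] [RightComodule k H V]

/-- The operator `v ↦ ψ(v₁) v₀` attached to a functional `ψ` on `H`. -/
def contractCoact (ψ : H →ₗ[k] k) : V →ₗ[k] V :=
  (TensorProduct.rid k V).toLinearMap ∘ₗ ψ.lTensor V ∘ₗ coact

theorem contractCoact_apply (ψ : H →ₗ[k] k) (v : V) :
    contractCoact ψ v = TensorProduct.rid k V (ψ.lTensor V (coact v)) := rfl

theorem contractCoact_counit (v : V) :
    contractCoact (Coalgebra.counit (R := k) (A := H)) v = v := by
  rw [contractCoact_apply, counit_apply, TensorProduct.rid_tmul, one_smul]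

/-- By coassociativity both sides are `φ(v₁)ψ(v₂)v₀`. Hence the span of all contractions of a fixed
`v` is stable under further contractions. -/
theorem contractCoact_contractCoact (φ ψ : H →ₗ[k] k) (v : V) :
    contractCoact φ (contractCoact ψ v) =
      contractCoact (LinearMap.mul' k k ∘ₗ TensorProduct.map φ ψ ∘ₗ Coalgebra.comul) v := by
  have h1 : ∀ x : V ⊗[k] H, contractCoact φ (TensorProduct.rid k V (ψ.lTensor V x)) =
      TensorProduct.rid k V ((LinearMap.mul' k k ∘ₗ TensorProduct.map φ ψ).lTensor V
        (TensorProduct.assoc k V H H ((coact (k := k) (H := H)).rTensor H x))) := by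
    intro x
    induction x with
    | zero => simp only [map_zero]
    | add x y hx hy => simp only [map_add, hx, hy]
    | tmul v h =>
      rw [LinearMap.lTensor_tmul, TensorProduct.rid_tmul, map_smul, contractCoact_apply,
        LinearMap.rTensor_tmul]
      generalize (coact v : V ⊗[k] H) = y
      induction y with
      | zero => simp
      | add x y hx hy => simp only [map_add, smul_add, TensorProduct.add_tmul, hx, hy]
      | tmul b c => simp [smul_smul, mul_comm]
  rw [contractCoact_apply ψ, h1, coassoc_apply, ← LinearMap.lTensor_comp_apply]
  rfl

/-- A subspace that is stable under all operators `v ↦ ψ(v₁) v₀`, i.e. a subcomodule. -/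
def IsSubcomodule (H : Type*) [AddCommGroup H] [Module k H] [Coalgebra k H]
    [RightComodule k H V] (N : Submodule k V) : Prop :=
  ∀ ψ : H →ₗ[k] k, ∀ v ∈ N, contractCoact ψ v ∈ N

theorem IsSubcomodule.sup {N N' : Submodule k V} (h : IsSubcomodule H N)
    (h' : IsSubcomodule H N') : IsSubcomodule H (N ⊔ N') := by
  intro ψ v hv
  obtain ⟨a, ha, b, hb, rfl⟩ := Submodule.mem_sup.1 hv
  rw [map_add]
  exact Submodule.add_mem_sup (h ψ a ha) (h' ψ b hb)

/-- By right exactness it suffices that the coaction of `v` vanishes in `(V/N) ⊗ H`. In a basis of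
`H` its coefficients there are classes of contractions of `v`, which lie in `N`. -/
theorem IsSubcomodule.exists_rTensor {N : Submodule k V} (h : IsSubcomodule H N) {v : V}
    (hv : v ∈ N) : coact v ∈ LinearMap.range (N.subtype.rTensor H) := by
  have hex : Function.Exact N.subtype N.mkQ := LinearMap.exact_subtype_mkQ N
  refine (rTensor_exact H hex N.mkQ_surjective _).1 ?_
  let b := Module.Basis.ofVectorSpace k H
  classical
  apply (TensorProduct.equivFinsuppOfBasisRight b).injective
  ext i
  have h1 : ∀ x : V ⊗[k] H, TensorProduct.rid k (V ⧸ N) ((b.coord i).lTensor _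
      (N.mkQ.rTensor H x)) = N.mkQ (TensorProduct.rid k V ((b.coord i).lTensor _ x)) := by
    intro x
    induction x with
    | zero => simp only [map_zero]
    | add x y hx hy => simp only [map_add, hx, hy]
    | tmul v h => simp
  rw [TensorProduct.equivFinsuppOfBasisRight_apply, h1, map_zero]
  exact (Submodule.Quotient.mk_eq_zero N).2 (h _ v hv)

/-- Coassociativity, read as colinearity of `v ↦ φ(v₀)v₁` into `H`. It makes `matrixCoeff` a
morphism. -/
theorem comul_lid_rTensor (φ : V →ₗ[k] k) (v : V) : Coalgebra.comul (R := k)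
    (TensorProduct.lid k H (φ.rTensor H (coact v : V ⊗[k] H))) =
    ((TensorProduct.lid k H).toLinearMap ∘ₗ φ.rTensor H ∘ₗ
      coact (k := k) (H := H) (V := V)).rTensor H (coact v : V ⊗[k] H) := by
  rw [← LinearMap.comp_assoc, LinearMap.rTensor_comp_apply, coassoc_apply']
  generalize (coact v : V ⊗[k] H) = z
  induction z with
  | zero => simp only [map_zero]
  | add x y hx hy => simp only [map_add, hx, hy]
  | tmul b c =>
    rw [LinearMap.rTensor_tmul, TensorProduct.lid_tmul, map_smul, LinearMap.lTensor_tmul]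
    generalize (Coalgebra.comul (R := k) c : H ⊗[k] H) = x
    induction x with
    | zero => simp
    | add x y hx hy => simp only [map_add, smul_add, TensorProduct.tmul_add, hx, hy]
    | tmul d e => simp [TensorProduct.smul_tmul']

theorem counit_lid_rTensor (φ : V →ₗ[k] k) (v : V) : Coalgebra.counit (R := k)
    (TensorProduct.lid k H (φ.rTensor H (coact v : V ⊗[k] H))) = φ v := by
  conv_rhs => rw [← contractCoact_counit (k := k) (H := H) v]
  rw [contractCoact_apply]
  generalize (coact v : V ⊗[k] H) = z
  induction z with
  | zero => simp only [map_zero]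
  | add x y hx hy => simp only [map_add, hx, hy]
  | tmul b c => simp [mul_comm]

/-- Every element of a comodule lies in a finite-dimensional subcomodule. -/
theorem exists_finite_subcomodule (H : Type*) [AddCommGroup H] [Module k H] [Coalgebra k H]
    [RightComodule k H V] (v : V) : ∃ N : Submodule k V,
    IsSubcomodule H N ∧ FiniteDimensional k N ∧ v ∈ N := by
  obtain ⟨F, hF, h⟩ := exists_finite_contract (coact v : V ⊗[k] H)
  -- All contractions of `v` lie in the finite-dimensional `F`, and contraction with the counit
  -- gives `v` itself.
  let N := Submodule.span k (Set.range fun ψ : H →ₗ[k] k => contractCoact ψ v)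
  have hN : N ≤ F := Submodule.span_le.2 (by rintro _ ⟨ψ, rfl⟩; exact h ψ)
  refine ⟨N, ?_, Submodule.finiteDimensional_of_le hN, ?_⟩
  · intro ψ w hw
    have h1 : N ≤ N.comap (contractCoact ψ) := by
      refine Submodule.span_le.2 ?_
      rintro _ ⟨φ, rfl⟩
      refine Submodule.subset_span ⟨_, (contractCoact_contractCoact ψ φ v).symm⟩
    exact h1 hw
  · exact Submodule.subset_span ⟨_, contractCoact_counit (H := H) v⟩

variable {N : Submodule k V} (hN : IsSubcomodule H N)

theorem rTensor_subtype_injective (A : Type*) [AddCommGroup A] [Module k A] (N : Submodule k V) :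
    Function.Injective (N.subtype.rTensor A) :=
  Module.Flat.rTensor_preserves_injective_linearMap _ N.subtype_injective

/-- The coaction on a subcomodule. -/
def IsSubcomodule.coact : N →ₗ[k] N ⊗[k] H :=
  (LinearEquiv.ofInjective _ (rTensor_subtype_injective H N)).symm.toLinearMap ∘ₗ
    (RightComodule.coact ∘ₗ N.subtype).codRestrict _ fun v => hN.exists_rTensor v.2

theorem IsSubcomodule.rTensor_coact (v : N) :
    N.subtype.rTensor H (hN.coact v) = RightComodule.coact v.1 :=
  congrArg Subtype.val ((LinearEquiv.ofInjective _ (rTensor_subtype_injective H N)).apply_symm_apply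
    ⟨RightComodule.coact v.1, hN.exists_rTensor v.2⟩)

/-- The comodule structure of a subcomodule. -/
abbrev IsSubcomodule.comodule : RightComodule k H N where
  coact := hN.coact
  coassoc := by
    ext1 v
    apply rTensor_subtype_injective (H ⊗[k] H) N
    have h1 : ∀ x : (N ⊗[k] H) ⊗[k] H, N.subtype.rTensor (H ⊗[k] H) (TensorProduct.assoc k N H H x) =
        TensorProduct.assoc k V H H ((N.subtype.rTensor H).rTensor H x) := by
      intro x
      induction x with
      | zero => simp only [map_zero]
      | add x y hx hy => simp only [map_add, hx, hy]
      | tmul y h =>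
        induction y with
        | zero => simp
        | add x y hx hy => simp only [map_add, TensorProduct.add_tmul, hx, hy]
        | tmul v h' => rfl
    have h2 : N.subtype.rTensor H ∘ₗ hN.coact = RightComodule.coact ∘ₗ N.subtype :=
      LinearMap.ext hN.rTensor_coact
    simp only [LinearMap.comp_apply, LinearEquiv.coe_coe]
    rw [h1, ← LinearMap.rTensor_comp_apply, h2, LinearMap.rTensor_comp_apply, hN.rTensor_coact,
      coassoc_apply, ← hN.rTensor_coact]
    exact (LinearMap.congr_fun (LinearMap.lTensor_comp_rTensor ..) _).trans
      (LinearMap.congr_fun (LinearMap.rTensor_comp_lTensor ..) _).symm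
  lTensor_counit_comp_coact := by
    ext1 v
    apply rTensor_subtype_injective k N
    rw [LinearMap.comp_apply, ← LinearMap.comp_apply, LinearMap.rTensor_comp_lTensor,
      ← LinearMap.lTensor_comp_rTensor, LinearMap.comp_apply, hN.rTensor_coact, counit_apply]
    rfl

end Subcomodule

/-! ### Subcomodules, the regular comodule and matrix coefficients -/

namespace Comod

open MonoidalCategory

variable {k H : Type u} [Field k] [Ring H] [HopfAlgebra k H]

/-- A subcomodule as an object of the category of comodules. -/
def sub {V : Comod k H} {N : Submodule k V} (hN : IsSubcomodule H N) : Comod k H :=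
  { carrier := N, comodule := hN.comodule }

section Sub

variable {V W : Comod k H} {N : Submodule k V} (hN : IsSubcomodule H N)

instance [FiniteDimensional k N] : FiniteDimensional k (sub hN) :=
  inferInstanceAs (FiniteDimensional k N)

/-- The inclusion of a subcomodule. -/
def subIncl : sub hN ⟶ V where
  lin := N.subtype
  coact_lin v := (hN.rTensor_coact v).symm

/-- A morphism with values in a subcomodule. -/
def subLift (φ : W ⟶ V) (h : ∀ w, toLin φ w ∈ N) : W ⟶ sub hN where
  lin := (toLin φ).codRestrict N h
  coact_lin w := by
    apply rTensor_subtype_injective H N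
    refine (hN.rTensor_coact _).trans ?_
    refine (coact_toLin φ w).trans ?_
    exact LinearMap.rTensor_comp_apply H N.subtype ((toLin φ).codRestrict N h) (coact w)

end Sub

theorem isSubcomodule_range {V W : Comod k H} (φ : W ⟶ V) :
    IsSubcomodule H (LinearMap.range (toLin φ)) := by
  rintro ψ _ ⟨w, rfl⟩
  refine ⟨contractCoact ψ w, ?_⟩
  rw [contractCoact_apply, contractCoact_apply, coact_toLin]
  generalize (coact w : W ⊗[k] H) = z
  induction z with
  | zero => simp only [map_zero]
  | add x y hx hy => simp only [map_add, hx, hy]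
  | tmul b c => simp

variable (k H) in
/-- The comodule `H`, with coaction the comultiplication. -/
def regular : Comod k H :=
  { carrier := H
    comodule :=
      { coact := Coalgebra.comul
        coassoc := Coalgebra.coassoc
        lTensor_counit_comp_coact := Coalgebra.lTensor_counit_comp_comul } }

variable (k H) in
/-- The counit as a functional on the regular comodule. -/
def regularCounit : regular k H →ₗ[k] k := Coalgebra.counit (R := k) (A := H)

/-- The morphism of comodules `w ↦ φ(w₀) w₁` from `W` to `H`. -/
def matrixCoeff {W : Comod k H} (φ : W →ₗ[k] k) : W ⟶ regular k H where
  lin := (TensorProduct.lid k H).toLinearMap ∘ₗ φ.rTensor H ∘ₗ coact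
  coact_lin := comul_lid_rTensor (H := H) φ

/-- Every functional thus factors through the counit of `H` along a morphism of comodules.
Naturality can then carry statements about functionals on `W` to the regular comodule. -/
theorem regularCounit_matrixCoeff {W : Comod k H} (φ : W →ₗ[k] k) :
    regularCounit k H ∘ₗ toLin (matrixCoeff φ) = φ :=
  LinearMap.ext (counit_lid_rTensor (H := H) φ)

theorem comul_linearMap (c : k) : Coalgebra.comul (R := k) (Algebra.linearMap k H c) =
    (Algebra.linearMap k H).rTensor H (c ⊗ₜ[k] (1 : H)) := by
  simp [Algebra.algebraMap_eq_smul_one, Algebra.TensorProduct.one_def, TensorProduct.smul_tmul']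

/-- The unit `k → H` as a morphism of comodules. -/
def regularUnit : 𝟙_ (Comod k H) ⟶ regular k H where
  lin := Algebra.linearMap k H
  coact_lin := comul_linearMap (H := H)

/-- Multiplicativity of `Δ` makes `v ⊗ w ↦ p(v)q(w)` colinear when `p` and `q` are. It is stated for
bare comodules and then packaged as `regularMul`. -/
theorem comul_mul'_map {V W : Type*} [AddCommGroup V] [Module k V] [RightComodule k H V]
    [AddCommGroup W] [Module k W] [RightComodule k H W] (p : V →ₗ[k] H) (q : W →ₗ[k] H)
    (hp : ∀ v, Coalgebra.comul (R := k) (p v) = p.rTensor H (coact v))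
    (hq : ∀ w, Coalgebra.comul (R := k) (q w) = q.rTensor H (coact w)) (x : V ⊗[k] W) :
    Coalgebra.comul (R := k) ((LinearMap.mul' k H ∘ₗ TensorProduct.map p q) x) =
      (LinearMap.mul' k H ∘ₗ TensorProduct.map p q).rTensor H
        (coact x : (V ⊗[k] W) ⊗[k] H) := by
  induction x with
  | zero => simp only [map_zero]
  | add x y hx hy => simp only [map_add, hx, hy]
  | tmul v w =>
    rw [LinearMap.comp_apply, TensorProduct.map_tmul, LinearMap.mul'_apply, comul_mul_eq, hp, hq,
      coact_tmul]
    generalize (coact v : V ⊗[k] H) = z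
    generalize (coact w : W ⊗[k] H) = y
    induction z with
    | zero => simp only [map_zero, LinearMap.zero_apply]
    | add x y hx hy => simp only [map_add, LinearMap.add_apply, hx, hy]
    | tmul a b =>
      induction y with
      | zero => simp only [map_zero]
      | add x y hx hy => simp only [map_add, hx, hy]
      | tmul c d => simp

/-- For morphisms `p : V → H` and `q : W → H`, the morphism `v ⊗ w ↦ p(v) q(w)`. -/
def regularMul {V W : Comod k H} (p : V ⟶ regular k H) (q : W ⟶ regular k H) :
    V ⊗ W ⟶ regular k H where
  lin := LinearMap.mul' k H ∘ₗ TensorProduct.map (toLin p) (toLin q)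
  coact_lin := comul_mul'_map (H := H) _ _ (coact_toLin p) (coact_toLin q)

end Comod

/-- For finite-dimensional `W` the embedding of `Hom(W, V) ⊗ H` into `Hom(W, V ⊗ H)` is onto, so the
condition on `ρ f` is empty. -/
theorem CoactionTwist.mem_homSub_of_finite {k H W V : Type*} [Field k] [Ring H] [Bialgebra k H]
    [AddCommGroup W] [Module k W] [RightComodule k H W] [AddCommGroup V] [Module k V]
    [RightComodule k H V] [FiniteDimensional k W] (t : CoactionTwist k H) (f : W →ₗ[k] V) :
    f ∈ t.homSub W V :=
  ⟨(rTensorHomEquivHomRTensor k W V H).symm (t.rho f), by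
    rw [← rTensorHomEquivHomRTensor_apply, LinearEquiv.apply_symm_apply]⟩

/-! ### Finite-dimensional comodules and finite-dimensional pieces of `H` -/

namespace Comod

open MonoidalCategory

variable {k H : Type u} [Field k] [Ring H] [HopfAlgebra k H]

instance (W W' : Comod k H) [FiniteDimensional k W] [FiniteDimensional k W'] :
    FiniteDimensional k (W ⊗ W' : Comod k H) :=
  inferInstanceAs (FiniteDimensional k (W ⊗[k] W'))

instance : FiniteDimensional k (𝟙_ (Comod k H)) := inferInstanceAs (FiniteDimensional k k)

/-- For finite-dimensional `W` every linear map `W → V` belongs to `Hom^l(W, V)`. -/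
def homLOfFinite (W V : Comod k H) [FiniteDimensional k W] : (W →ₗ[k] V) →ₗ[k] homL W V :=
  LinearMap.id.codRestrict _ fun f => (leftTwist k H).mem_homSub_of_finite f

theorem exists_finite_subcomodule_regular (h : H) : ∃ N : Submodule k (regular k H),
    IsSubcomodule H N ∧ FiniteDimensional k N ∧ h ∈ N :=
  exists_finite_subcomodule (V := regular k H) H h

variable (k) in
/-- A finite-dimensional subcomodule of `H` that contains `h`. -/
def coeffSub (h : H) : Submodule k (regular k H) :=
  (exists_finite_subcomodule_regular h).choose

variable (k) in
theorem isSubcomodule_coeffSub (h : H) : IsSubcomodule H (coeffSub k h) :=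
  (exists_finite_subcomodule_regular h).choose_spec.1

instance (h : H) : FiniteDimensional k (coeffSub k h) :=
  (exists_finite_subcomodule_regular h).choose_spec.2.1

variable (k) in
theorem mem_coeffSub (h : H) : h ∈ coeffSub k h :=
  (exists_finite_subcomodule_regular h).choose_spec.2.2

variable (k) in
/-- The element `h` of `coeffSub k h`. -/
def coeffElt (h : H) : sub (isSubcomodule_coeffSub k h) := ⟨h, mem_coeffSub k h⟩

variable (k) in
/-- The inclusion of `coeffSub k h` into `H`. -/
abbrev coeffIncl (h : H) : sub (isSubcomodule_coeffSub k h) ⟶ regular k H :=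
  subIncl (isSubcomodule_coeffSub k h)

end Comod

/-! ### The action of `H` attached to a central structure -/

namespace CentralStructure

open MonoidalCategory Comod

variable {k H : Type u} [Field k] [Ring H] [HopfAlgebra k H] [HasBijectiveAntipode k H]
  {X : Comod k H} (t : CentralStructure (Comod k H) (Comod k H)ᵒᵖ (op X))

/-- The morphism `Hom^l(W, X) → Hom^r(W, X)` of a central structure on `X`. -/
def sigma (W : Comod k H) : homL W X ⟶ homR W X := (t.τ W).inv.unop

theorem ihomVal_sigma_comp {W W' : Comod k H} (φ : W ⟶ W') (f : homL W' X) (w : W) :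
    ihomVal (rightTwist k H) W X
      (toLin (t.sigma W) (toLin (ihomMap (leftTwist k H) φ (𝟙 X)) f)) w =
    ihomVal (rightTwist k H) W' X (toLin (t.sigma W') f) (toLin φ w) :=
  congrArg (fun g : op (homR W X) ⟶ op (homL W' X) =>
    ihomVal (rightTwist k H) W X (toLin g.unop f) w) (t.inv_naturality φ)

/-- The operator on `Hom_k(W, X)`, for finite-dimensional `W`, of a central structure on `X`. -/
def finOp (W : Comod k H) [FiniteDimensional k W] : (W →ₗ[k] X) →ₗ[k] (W →ₗ[k] X) :=
  ihomVal (rightTwist k H) W X ∘ₗ toLin (t.sigma W) ∘ₗ homLOfFinite W X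

theorem finOp_comp {W W' : Comod k H} [FiniteDimensional k W] [FiniteDimensional k W'] (φ : W ⟶ W')
    (f : W' →ₗ[k] X) (w : W) : t.finOp W (f ∘ₗ toLin φ) w = t.finOp W' f (toLin φ w) :=
  t.ihomVal_sigma_comp φ (homLOfFinite W' X f) w

theorem finOp_unit (f : k →ₗ[k] X) : t.finOp (𝟙_ (Comod k H)) f (1 : k) = f 1 := by
  have h : ihomVal (rightTwist k H) (𝟙_ (Comod k H)) X (toLin (t.sigma (𝟙_ (Comod k H)))
      (toLin (ihomUnit (leftTwist k H) (fun a => mul_one a) X).inv (f 1))) (1 : k) =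
      (1 : k) • f 1 :=
    congrArg (fun g : op (homR (𝟙_ (Comod k H)) X) ⟶ op X =>
      ihomVal (rightTwist k H) (𝟙_ (Comod k H)) X (toLin g.unop (f 1)) (1 : k)) t.inv_unit
  rw [one_smul] at h
  rw [← h]
  refine congrArg (fun f => t.finOp (𝟙_ (Comod k H)) f (1 : k)) ?_
  exact LinearMap.ext_ring (one_smul k (f 1)).symm

/-- The tensor condition, in the form of `tensor_iff`, evaluated at `f`, `w'` and `w`. The currying
and exchange constraints unfold by definition. -/
theorem finOp_tensor {W W' : Comod k H} [FiniteDimensional k W] [FiniteDimensional k W']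
    (f : W ⊗[k] W' →ₗ[k] X) (w : W) (w' : W') : t.finOp (W ⊗ W') f (w ⊗ₜ[k] w' : W ⊗[k] W') =
      t.finOp W ((t.finOp W' ∘ₗ TensorProduct.curry f).flip w') w := by
  have h := (tensor_iff t.τ W W').1 (t.tensor W W')
  have h2 := congrArg (fun g : op (homR W' (homR W X)) ⟶ op (homL (W ⊗ W') X) =>
    ihomVal (rightTwist k H) W X (ihomVal (rightTwist k H) W' (homR W X)
      (toLin g.unop (homLOfFinite (W ⊗ W') X f)) w') w) h
  exact h2

/-- The operator of a central structure applied to `w ↦ ε(q(w)) m`, for a morphism `q : W → H`. -/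
def coeffOp {W : Comod k H} [FiniteDimensional k W] (q : W ⟶ regular k H) : X →ₗ[k] W →ₗ[k] X :=
  t.finOp W ∘ₗ LinearMap.smulRightₗ (regularCounit k H ∘ₗ toLin q)

theorem coeffOp_apply {W : Comod k H} [FiniteDimensional k W] (q : W ⟶ regular k H) (m : X) :
    t.coeffOp q m = t.finOp W ((regularCounit k H ∘ₗ toLin q).smulRight m) := rfl

theorem coeffOp_comp {W W' : Comod k H} [FiniteDimensional k W] [FiniteDimensional k W']
    (φ : W ⟶ W') (q : W' ⟶ regular k H) (m : X) (w : W) :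
    t.coeffOp (φ ≫ q) m w = t.coeffOp q m (toLin φ w) :=
  t.finOp_comp φ ((regularCounit k H ∘ₗ toLin q).smulRight m) w

/-- Since `ε(p(v)q(v')) = ε(p(v))ε(q(v'))`, the scalar `ε(p(v))` comes out of the inner operator by
linearity. What remains is the operator for `p` applied to the value of the one for `q`. -/
theorem coeffOp_regularMul {W W' : Comod k H} [FiniteDimensional k W] [FiniteDimensional k W']
    (p : W ⟶ regular k H) (q : W' ⟶ regular k H) (m : X) (w : W) (w' : W') :
    t.coeffOp (regularMul p q) m (w ⊗ₜ[k] w' : W ⊗[k] W') =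
      t.coeffOp p (t.coeffOp q m w') w := by
  refine (t.finOp_tensor _ w w').trans ?_
  refine congrArg (fun f => t.finOp W f w) (LinearMap.ext fun v => ?_)
  refine Eq.trans (congrArg (fun f => t.finOp W' f w') (?_ : _ = regularCounit k H (toLin p v) •
    (regularCounit k H ∘ₗ toLin q).smulRight m)) ?_
  · refine LinearMap.ext fun v' => ?_
    refine Eq.trans ?_ (smul_smul (regularCounit k H (toLin p v)) (regularCounit k H (toLin q v'))
      m).symm
    exact congrArg (· • m) (Bialgebra.counit_mul (R := k) (A := H) (toLin p v) (toLin q v'))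
  · exact congrArg (fun f => f w') ((t.finOp W').map_smul _ _)

/-- The action of `H` given by a central structure. -/
def hmul (h : H) : X →ₗ[k] X := (t.coeffOp (coeffIncl k h)).flip (coeffElt k h)

/-- Both `q` and the inclusion of the chosen subcomodule around `q(w)` factor through one
finite-dimensional subcomodule of `H`. Naturality identifies each side with the value there at the
element `q(w)`. In particular the action does not depend on the choice behind `coeffSub`. -/
theorem coeffOp_eq_hmul {W : Comod k H} [FiniteDimensional k W] (q : W ⟶ regular k H) (m : X)
    (w : W) : t.coeffOp q m w = t.hmul (toLin q w) m := by
  let h : H := toLin q w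
  have hN := (isSubcomodule_coeffSub k h).sup (isSubcomodule_range q)
  have : FiniteDimensional k (LinearMap.range (toLin q)) := LinearMap.finiteDimensional_range _
  have h1 := t.coeffOp_comp (subLift hN q fun w => Submodule.mem_sup_right ⟨w, rfl⟩)
    (subIncl hN) m w
  have h2 := t.coeffOp_comp (subLift hN (coeffIncl k h)
    fun w => Submodule.mem_sup_left w.2) (subIncl hN) m (coeffElt k h)
  exact h1.trans h2.symm

/-- The element `1` is the image of `1 ∈ k` under the colinear unit `k → H`, and the operator on `k`
is normalised by the unit condition. -/
theorem one_hmul (m : X) : t.hmul 1 m = m := by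
  have h := t.coeffOp_eq_hmul (regularUnit (k := k) (H := H)) m (1 : k)
  have h1 : toLin (regularUnit (k := k) (H := H)) (1 : k) = (1 : H) := map_one (algebraMap k H)
  refine (congrArg (fun g => t.hmul g m) h1).symm.trans (h.symm.trans ?_)
  refine (t.finOp_unit _).trans ?_
  refine Eq.trans (congrArg (fun c : k => c • m) ?_) (one_smul k m)
  exact (congrArg (Coalgebra.counit (R := k) (A := H)) h1).trans Bialgebra.counit_one

theorem mul_hmul (g h : H) (m : X) : t.hmul (g * h) m = t.hmul g (t.hmul h m) :=
  (t.coeffOp_eq_hmul (regularMul (coeffIncl k g) (coeffIncl k h)) m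
    (coeffElt k g ⊗ₜ[k] coeffElt k h)).symm.trans
    (t.coeffOp_regularMul (coeffIncl k g) (coeffIncl k h) m (coeffElt k g) (coeffElt k h))

/-- The subcomodule in the definition of `hmul` varies with the element, so additivity is read off
in a single subcomodule containing both `g` and `h`. -/
theorem add_hmul (g h : H) (m : X) : t.hmul (g + h) m = t.hmul g m + t.hmul h m := by
  have hN := (isSubcomodule_coeffSub k g).sup (isSubcomodule_coeffSub k h)
  let x : sub hN := ⟨g, Submodule.mem_sup_left (mem_coeffSub k g)⟩
  let y : sub hN := ⟨h, Submodule.mem_sup_right (mem_coeffSub k h)⟩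
  have key := fun x => t.coeffOp_eq_hmul (subIncl hN) m x
  exact (key (x + y)).symm.trans ((LinearMap.map_add _ x y).trans
    (congrArg₂ (· + ·) (key x) (key y)))

theorem smul_hmul (c : k) (h : H) (m : X) : t.hmul (c • h) m = c • t.hmul h m :=
  (t.coeffOp_eq_hmul (coeffIncl k h) m (c • coeffElt k h)).symm.trans
    (LinearMap.map_smul _ c (coeffElt k h))

/-- The module structure over `H` given by a central structure. -/
abbrev hmodule : Module H X where
  smul h m := t.hmul h m
  one_smul := t.one_hmul
  mul_smul := t.mul_hmul
  smul_zero h := (t.hmul h).map_zero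
  smul_add h := (t.hmul h).map_add
  add_smul := t.add_hmul
  zero_smul m := by
    have := t.smul_hmul 0 0 m
    rwa [zero_smul, zero_smul] at this

end CentralStructure

theorem lift_comp_smulRight {k H W N N' : Type*} [Field k] [AddCommGroup H] [Module k H]
    [AddCommGroup W] [Module k W] [AddCommGroup N] [Module k N] [AddCommGroup N'] [Module k N']
    (β : N →ₗ[k] H →ₗ[k] N') (φ : W →ₗ[k] k) (n : N) (z : W ⊗[k] H) :
    TensorProduct.lift (β ∘ₗ φ.smulRight n) z = β n (TensorProduct.lid k H (φ.rTensor H z)) := by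
  induction z with
  | zero => simp only [map_zero]
  | add x y hx hy => simp only [map_add, hx, hy]
  | tmul b c => simp

/-! ### Evaluation on rank-one maps `ε(q(·))n` -/

namespace Comod

variable {k H : Type u} [Field k] [Ring H] [HopfAlgebra k H]

/-- Colinearity of `q` turns `ε(q(w₀))w₁` into `ε(q(w)₁)q(w)₂`, and the counit axiom of `H`
finishes. -/
theorem lid_regularCounit {W : Comod k H} (q : W ⟶ regular k H) (w : W) :
    TensorProduct.lid k H ((regularCounit k H ∘ₗ toLin q).rTensor H (coact w)) = toLin q w := by
  have h1 : (toLin q).rTensor H (coact w) = Coalgebra.comul (R := k) (A := H) (toLin q w) :=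
    (coact_toLin q w).symm
  rw [LinearMap.rTensor_comp_apply, h1]
  exact (congrArg (TensorProduct.lid k H)
    (Coalgebra.rTensor_counit_comul (R := k) (A := H) (toLin q w))).trans (one_smul k _)

/-- Evaluation of `w ↦ β (ε(q(w₀)) n) w₁`. -/
theorem bindCoact_smulRight {N N' : Type*} [AddCommGroup N] [Module k N] [AddCommGroup N']
    [Module k N'] (β : N →ₗ[k] H →ₗ[k] N') {W : Comod k H} (q : W ⟶ regular k H) (n : N) (w : W) :
    bindCoact β ((regularCounit k H ∘ₗ toLin q).smulRight n) w = β n (toLin q w) :=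
  (lift_comp_smulRight β _ n _).trans (congrArg (β n) (lid_regularCounit q w))

end Comod

/-! ### Recovering the central structure and the anti-Yetter–Drinfeld equation -/

namespace CentralStructure

open MonoidalCategory Comod

variable {k H : Type u} [Field k] [Ring H] [HopfAlgebra k H] [HasBijectiveAntipode k H]
  {X : Comod k H} (t : CentralStructure (Comod k H) (Comod k H)ᵒᵖ (op X))

/-- The action of `H` given by a central structure, as a bilinear map. -/
def actBilin : X →ₗ[k] H →ₗ[k] X :=
  LinearMap.flip
    { toFun := t.hmul
      map_add' := fun g h => LinearMap.ext (t.add_hmul g h)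
      map_smul' := fun c h => LinearMap.ext (t.smul_hmul c h) }

/-- Both sides are linear in `f`, and rank-one maps `φ(·)m` span. For these, `φ` is the counit
composed with `matrixCoeff φ`, so both sides are the action of `φ(w₀)w₁` on `m`. -/
theorem finOp_eq_bindCoact {W : Comod k H} [FiniteDimensional k W] (f : W →ₗ[k] X) :
    t.finOp W f = bindCoact t.actBilin f := by
  let b := Module.finBasis k W
  have hf : f = ∑ i, (b.coord i).smulRight (f (b i)) := b.ext fun j => by
    simp [Finsupp.single_apply]
  have key : ∀ (φ : W →ₗ[k] k) (m : X),
      t.finOp W (φ.smulRight m) = bindCoact t.actBilin (φ.smulRight m) := by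
    intro φ m
    ext w
    have h := bindCoact_smulRight t.actBilin (matrixCoeff φ) m w
    have h' := t.coeffOp_eq_hmul (matrixCoeff φ) m w
    rw [coeffOp_apply] at h'
    rw [regularCounit_matrixCoeff] at h h'
    exact h'.trans h.symm
  rw [hf, map_sum, map_sum]
  exact Finset.sum_congr rfl fun i _ => key _ _

/-- Each `w` lies in a finite-dimensional subcomodule. Both sides are natural along its inclusion,
so the finite-dimensional case suffices. -/
theorem ihomVal_sigma {W : Comod k H} (f : homL W X) :
    ihomVal (rightTwist k H) W X (toLin (t.sigma W) f) =
      bindCoact t.actBilin (ihomVal (leftTwist k H) W X f) := by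
  ext w
  obtain ⟨N, hN, hfin, hw⟩ := exists_finite_subcomodule (k := k) H w
  have h1 := t.ihomVal_sigma_comp (subIncl hN) f ⟨w, hw⟩
  have h2 := LinearMap.congr_fun (t.finOp_eq_bindCoact (W := sub hN)
    (ihomVal (leftTwist k H) W X f ∘ₗ toLin (subIncl hN))) ⟨w, hw⟩
  exact h1.symm.trans (h2.trans (bindCoact_comp t.actBilin (subIncl hN) _ _))

/-- The underlying linear map of `sigma`. -/
def sigmaSub (W : Comod k H) : (leftTwist k H).homSub W X →ₗ[k] (rightTwist k H).homSub W X :=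
  toLin (t.sigma W)

theorem subtype_comp_sigmaSub (W : Comod k H) :
    ((rightTwist k H).homSub W X).subtype ∘ₗ t.sigmaSub W =
      bindCoact t.actBilin ∘ₗ ((leftTwist k H).homSub W X).subtype :=
  LinearMap.ext fun f => t.ihomVal_sigma f

theorem homCoact_sigmaSub {W : Comod k H} (f : (leftTwist k H).homSub W X) :
    (rightTwist k H).homCoact W X (t.sigmaSub W f) =
      (t.sigmaSub W).rTensor H ((leftTwist k H).homCoact W X f) :=
  coact_toLin (t.sigma W) f

/-- The converse of the route through `coact_comp_tauMap`: the identity is now extracted from the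
assumed colinearity of `sigma`, and so holds for `f` in `Hom^l(W, X)`. -/
theorem coact_comp_bindCoact {W : Comod k H} (f : (leftTwist k H).homSub W X) :
    coact (k := k) (H := H) ∘ₗ bindCoact t.actBilin f.1 = twist (rightTwist k H).inv
      (bindCoact (extendAct t.actBilin)
        (twist (leftTwist k H).op (coact (k := k) (H := H) ∘ₗ f.1))) := by
  have h := (rightTwist k H).evalSub_homCoact (t.sigmaSub W f)
  rw [homCoact_sigmaSub, CoactionTwist.evalSub, LinearMap.comp_apply,
    ← LinearMap.rTensor_comp_apply, subtype_comp_sigmaSub, LinearMap.rTensor_comp_apply,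
    ← twist_homTensor, ← bindCoact_homTensor, CoactionTwist.homTensor_homCoact,
    CoactionTwist.rho_eq_twist] at h
  rw [h]
  exact congrArg _ (t.ihomVal_sigma f).symm

/-- The anti-Yetter–Drinfeld module given by a central structure. -/
def aydModule : AYDModule k H :=
  letI := t.hmodule
  haveI : IsScalarTower k H X := ⟨t.smul_hmul⟩
  { carrier := X
    hmodule := t.hmodule
    coact_smul := fun h m => by
      -- The test map is `n ↦ ε(n)m` on a finite-dimensional subcomodule of `H` containing `h`,
      -- evaluated at `h`. There `n ↦ β(ε(n₀)x, n₁)` takes the value `β(x, h)`, so the two sides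
      -- become the coaction of `hm` and `aydBilin` at the coaction of `m`.
      have h1 := LinearMap.congr_fun (t.coact_comp_bindCoact
        (homLOfFinite (sub (isSubcomodule_coeffSub k h)) X
          ((regularCounit k H ∘ₗ toLin (coeffIncl k h)).smulRight m))) (coeffElt k h)
      have h2 := twist_bindCoact_twist (k := k) (H := H) (M := X)
        (coact (k := k) (H := H) ∘ₗ
          (regularCounit k H ∘ₗ toLin (coeffIncl k h)).smulRight m)
      have h3 : coact (k := k) (H := H) ∘ₗ
          (regularCounit k H ∘ₗ toLin (coeffIncl k h)).smulRight m =
          (regularCounit k H ∘ₗ toLin (coeffIncl k h)).smulRight (coact m) := by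
        ext w
        simp
      refine (congrArg coact (bindCoact_smulRight t.actBilin (coeffIncl k h) m
        (coeffElt k h))).symm.trans (h1.trans ((LinearMap.congr_fun h2 (coeffElt k h)).trans ?_))
      rw [h3]
      exact (bindCoact_smulRight (aydBilin k H X) (coeffIncl k h) (coact m) (coeffElt k h)).trans
        (aydBilin_apply _ _) }

theorem ext_inv {X : Comod k H} {s t : CentralStructure (Comod k H) (Comod k H)ᵒᵖ (op X)}
    (h : ∀ (W : Comod k H) (f : homL W X), ihomVal (rightTwist k H) W X (toLin (s.sigma W) f) =
      ihomVal (rightTwist k H) W X (toLin (t.sigma W) f)) : s = t := by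
  have h1 : s.τ = t.τ := funext fun W => Iso.ext_inv
    (Quiver.Hom.unop_inj (to_ihom_ext _ (h W)))
  cases s
  cases t
  cases h1
  rfl

/-- Both structures are `w ↦ w₁f(w₀)` for the same action, by `ihomVal_sigma`. -/
theorem central_aydModule : t.aydModule.central = t :=
  ext_inv fun _ f => (t.ihomVal_sigma f).symm

end CentralStructure

/-! ### The equivalence -/

namespace AYDModule

open Comod

variable {k H : Type u} [Field k] [Ring H] [HopfAlgebra k H]

theorem tauMap_coeffElt (M : AYDModule k H) (h : H) (m : M) :
    M.tauMap ((regularCounit k H ∘ₗ toLin (coeffIncl k h)).smulRight m) (coeffElt k h) = h • m :=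
  bindCoact_smulRight M.act (coeffIncl k h) m (coeffElt k h)

variable [HasBijectiveAntipode k H]

/-- Compatibility with `τ` on the test map `n ↦ ε(n)m`, evaluated at `h`, reads `θ(hm) = hθ(m)`. So
a morphism of the center is automatically `H`-linear. -/
instance : (toCenter k H).Full where
  map_surjective {M N} F := by
    let θ : M.comod ⟶ N.comod := F.unop.f.unop
    refine ⟨{ hom := θ, map_hsmul := fun h m => ?_ }, rfl⟩
    let f : sub (isSubcomodule_coeffSub k h) →ₗ[k] M :=
      (regularCounit k H ∘ₗ toLin (coeffIncl k h)).smulRight m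
    let W := sub (isSubcomodule_coeffSub k h)
    have h1 : N.tauMap (toLin θ ∘ₗ f) (coeffElt k h) = toLin θ (M.tauMap f (coeffElt k h)) :=
      congrArg (fun g : op (homR W N.comod) ⟶ op (homL W M.comod) =>
        ihomVal (rightTwist k H) W N.comod (toLin g.unop (homLOfFinite W M.comod f))
          (coeffElt k h)) (BimoduleCenter.Hom.inv_comm F.unop W)
    have h2 : toLin θ ∘ₗ f = (regularCounit k H ∘ₗ toLin (coeffIncl k h)).smulRight (toLin θ m) :=
      LinearMap.ext fun w => LinearMap.map_smul (toLin θ) _ m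
    rw [h2, tauMap_coeffElt, tauMap_coeffElt] at h1
    exact h1.symm

/-- An equality of objects, not merely an isomorphism, because the reconstructed module keeps the
underlying comodule of `Y`. -/
theorem toCenter_obj_aydModule (Y : (BimoduleCenter (Comod k H) (Comod k H)ᵒᵖ)ᵒᵖ) :
    (toCenter k H).obj (CentralStructure.aydModule (X := Y.unop.obj.unop) Y.unop.central) = Y :=
  congrArg (fun c => op (⟨Y.unop.obj, c⟩ : BimoduleCenter (Comod k H) (Comod k H)ᵒᵖ))
    (CentralStructure.central_aydModule (X := Y.unop.obj.unop) Y.unop.central)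

instance : (toCenter k H).EssSurj where
  mem_essImage Y := ⟨_, ⟨eqToIso (toCenter_obj_aydModule Y)⟩⟩

instance : (toCenter k H).IsEquivalence where

end AYDModule

end

/-- Arrows of the bimodule category are reversed morphisms of comodules. This is why the center
appears with an outer `ᵒᵖ`, and why the map `Hom^l → Hom^r` is `(c.τ W).inv.unop`. -/
theorem mainTheorem1 {k H : Type u} [Field k] [Ring H] [HopfAlgebra k H]
    [HasBijectiveAntipode k H] :
    ∃ e : AYDModule k H ≌ (BimoduleCenter (Comod k H) (Comod k H)ᵒᵖ)ᵒᵖ,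
      e.functor ⋙ (BimoduleCenter.forget (Comod k H) (Comod k H)ᵒᵖ).leftOp =
        AYDModule.toComod k H ∧
      ∀ M : AYDModule k H,
        ∃ c : CentralStructure (Comod k H) (Comod k H)ᵒᵖ (op M.comod),
          (e.functor.obj M).unop = ⟨op M.comod, c⟩ ∧
          ∀ (W : Comod k H) (f : Comod.homL W M.comod),
            Comod.ihomVal (rightTwist k H) W M.comod (Comod.toLin (c.τ W).inv.unop f) =
              M.tauMap (Comod.ihomVal (leftTwist k H) W M.comod f) :=
  ⟨(AYDModule.toCenter k H).asEquivalence, AYDModule.toCenter_comp_forget,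
    fun M => ⟨M.central, rfl, M.central_inv⟩⟩
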